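/- **Setting.** Let $d\in\{2,3\}$ and $T_f>0$. For $F\in\mathbb R^{d\times d}$ let $\Phi(F)=(F,\operatorname{cof}F,\det F)\in\mathbb R^{D}$, $D=19$, if $d=3$, and $\Phi(F)=(F,\det F)\in\mathbb R^{D}$, $D=5$, if $d=2$; components are written $\Phi^A$, and repeated indices are summed. Let $\sigma_I\in C^2(\mathbb R^D)$, $\sigma_E\in C^3(\mathbb R^D)$ and $\Sigma=\sigma_I-\sigma_E$, and assume (h$_0$): $\nabla^2\Sigma>0$ everywhere and $\nabla\Sigma:\mathbb R^D\to\mathbb R^D$ is onto. Let $G$ be the solution of $\nabla G(\tau)=-(\nabla\Sigma)^{-1}(-\tau)$ normalized by $G(-\nabla\Sigma(\Xi))=\Xi\cdot\nabla\Sigma(\Xi)-\Sigma(\Xi)$, and put $\Psi(\Xi,\tau)=\sigma_I(\Xi)+\Xi\cdot\tau+G(\tau)$, so that $\Psi(\Xi,-\nabla\Sigma(\Xi))=\sigma_E(\Xi)$. For $\varepsilon>0$ let $(v,F,T)=(v^\varepsilon,F^\varepsilon,T^\varepsilon)$, with $F=\nabla y$ for some $y$, be a classical ($C^1$ up to $t=0$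 and $t=T_f$) solution on $\mathbb R^d\times[0,T_f]$ of the relaxation system $$\partial_t v_i-\partial_\alpha\Big(T^A\frac{\partial\Phi^A}{\partial F_{i\alpha}}(F)\Big)=0,\quad \partial_tF_{i\alpha}-\partial_\alpha v_i=0,\quad \partial_t\Big(T^A-\frac{\partial\sigma_I}{\partial\Xi^A}(\Phi(F))\Big)=-\frac1\varepsilon\Big(T^A-\frac{\partial\sigma_E}{\partial\Xi^A}(\Phi(F))\Big),\quad \partial_\beta F_{i\alpha}-\partial_\alpha F_{i\beta}=0,$$ and let $(\hat v,\hat F)$, with $\hat F=\nabla\hat y$ for some $\hat y$, be a classical solution on $\mathbb R^d\times[0,T_f]$ of $$\partial_t\hat v_i-\partial_\alpha\Big(\frac{\partial\sigma_E}{\partial\Xi^A}(\Phi(\hat F))\frac{\partial\Phi^A}{\partial F_{i\alpha}}(\hat F)\Big)=0,\qquad \partial_t\hat F_{i\alpha}-\partial_\alpha\hat v_i=0.$$ Put $\tau=T-\nabla\sigma_I(\Phi(F))$, $\tau_\infty(\hat F)=\nabla(\sigma_E-\sigma_I)(\Phi(\hat F))$, and, with $\Xi=\Phi(F)$, $\hat\Xi=\Phi(\hat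 F)$, $$e_r=\tfrac12|v-\hat v|^2+\Psi(\Xi,\tau)-\sigma_E(\hat\Xi)-\frac{\partial\sigma_E}{\partial\Xi^A}(\hat\Xi)\,(\Xi^A-\hat\Xi^A),\qquad f_\alpha=\Big(T^A-\frac{\partial\sigma_E}{\partial\Xi^A}(\hat\Xi)\Big)(v_i-\hat v_i)\frac{\partial\Phi^A}{\partial F_{i\alpha}}(F),$$ $$\mathcal D=\frac{\partial\Psi}{\partial\tau^A}(\Xi,\tau)\Big(T^A-\frac{\partial\sigma_E}{\partial\Xi^A}(\Xi)\Big),\qquad L=\partial_\alpha\hat v_i\Big(T^A-\frac{\partial\sigma_E}{\partial\Xi^A}(\Xi)\Big)\frac{\partial\Phi^A}{\partial F_{i\alpha}}(F),$$ $$Q_1=\partial_\alpha\Big(\frac{\partial\sigma_E}{\partial\Xi^A}(\hat\Xi)\Big)\Big(\frac{\partial\Phi^A}{\partial F_{i\alpha}}(F)-\frac{\partial\Phi^A}{\partial F_{i\alpha}}(\hat F)\Big)(v_i-\hat v_i),$$ $$Q_2=\partial_\alpha\hat v_i\,\frac{\partial\Phi^A}{\partial F_{i\alpha}}(\hat F)\Big(\frac{\partial\sigma_E}{\partial\Xi^A}(\Xi)-\frac{\partial\sigma_E}{\partial\Xi^A}(\hat\Xi)-\frac{\partial^2\sigma_E}{\partial\Xi^A\partial\Xi^B}(\hat\Xi)(\Xi^B-\hat\Xi^B)\Big),$$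 $$Q_3=\partial_\alpha\hat v_i\Big(\frac{\partial\sigma_E}{\partial\Xi^A}(\Xi)-\frac{\partial\sigma_E}{\partial\Xi^A}(\hat\Xi)\Big)\Big(\frac{\partial\Phi^A}{\partial F_{i\alpha}}(F)-\frac{\partial\Phi^A}{\partial F_{i\alpha}}(\hat F)\Big).$$ **Theorem 4.1.** (i) On $\mathbb R^d\times[0,T_f]$ (with one-sided time derivatives at $t=0,T_f$), $e_r$ is differentiable in $t$, the $f_\alpha$ are differentiable in $x$, and $$\partial_te_r-\partial_\alpha f_\alpha+\frac1\varepsilon\mathcal D=Q_1+Q_2+Q_3+L .$$ For (ii) and (iii) assume in addition that, for constants $\gamma_I>\gamma_v>0$ and $M>0$, $$(\mathrm h_1)\quad \nabla^2\sigma_I\ge\gamma_I\mathbb I>\gamma_v\mathbb I\ge\nabla^2(\sigma_I-\sigma_E)>0,\qquad\qquad (\mathrm h_2)\quad|\nabla^2\sigma_E|\le M,\ \ |\nabla^3\sigma_E|\le M\quad\text{on }\mathbb R^D,$$ and that the solutions decay fast to a common constant equilibrium state: for some constant matrix $\bar F$ (for instance $\bar F=0$), the functions $v$, $F-\bar F$,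 $T-\nabla\sigma_E(\Phi(\bar F))$, $\hat v$, $\hat F-\bar F$ and their first spatial derivatives are, for every $N$, $O((1+|x|)^{-N})$ uniformly in $t\in[0,T_f]$. (ii) There is a constant $C>0$ depending only on $d,T_f,\gamma_I,\gamma_v,M,\bar F$ and the functions $\nabla\hat v,\nabla\hat F$ on $\mathbb R^d\times[0,T_f]$ (in particular not on $\varepsilon>0$ or on the solution of the relaxation system) such that for all $t\in[0,T_f]$ the function $e_r(\cdot,t)$ is integrable and $$\int_{\mathbb R^d}e_r(x,t)\,dx\le C\Big(\int_{\mathbb R^d}e_r(x,0)\,dx+\varepsilon\Big).$$ (iii) If such solutions $(v^\varepsilon,F^\varepsilon,T^\varepsilon)$ are given for all sufficiently small $\varepsilon>0$ and their relative energies $e_r^\varepsilon$ satisfy $\int_{\mathbb R^d}e^\varepsilon_r(x,0)\,dx\to0$ as $\varepsilon\downarrow0$, then, as $\varepsilon\downarrow0$, $$\sup_{t\in[0,T_f]}\int_{\mathbb R^d}|v^\varepsilon-\hat v|^2+|F^\varepsilon-\hat F|^2+|\tau^\varepsilon-\tau_\infty(\hat F)|^2\,dx\longrightarrow0 .$$ 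-/

import Mathlib

open Set Filter Topology MeasureTheory

noncomputable section

namespace PolyRelax

/-- Physical space `ℝ^d` with the Euclidean norm. -/
abbrev Space (d : ℕ) : Type := EuclideanSpace ℝ (Fin d)

/-- Matrices `F = (F_{iα})`, `i, α = 1, …, d`. -/
abbrev Mat (d : ℕ) : Type := Matrix (Fin d) (Fin d) ℝ

/-- Index set of the null Lagrangians: the entries of `F`, the entries of `cof F` (these are listed
separately only if `d = 3`; for `d = 2` they are, up to sign, the entries of `F`), and `det F`.
It has `19` elements for `d = 3` and `5` elements for `d = 2`. -/
abbrev MinorIdx (d : ℕ) : Type :=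
  (Fin d × Fin d) ⊕ ({_p : Fin d × Fin d // d = 3} ⊕ Unit)

/-- The space `ℝ^D`, `D = 19` for `d = 3` and `D = 5` for `d = 2`. -/
abbrev MinorSpace (d : ℕ) : Type := EuclideanSpace ℝ (MinorIdx d)

/-- The cofactor matrix. -/
def cof {d : ℕ} (F : Mat d) : Mat d := F.adjugate.transpose

/-- `Φ(F) = (F, cof F, det F)` for `d = 3`, and `Φ(F) = (F, det F)` for `d = 2`. -/
def Phi {d : ℕ} (F : Mat d) : MinorSpace d :=
  WithLp.toLp 2 (Sum.elim (fun p => F p.1 p.2)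
    (Sum.elim (fun p => cof F p.1.1 p.1.2) (fun _ => F.det)))

/-- The vector `(∂Φ^A / ∂F_{iα}(F))_A`. -/
def dPhi {d : ℕ} (F : Mat d) (i α : Fin d) : MinorSpace d :=
  lineDeriv ℝ Phi F (Matrix.single i α 1)

/-- The spatial partial derivative `∂_α u (x)`. -/
def pd {d : ℕ} (α : Fin d) (u : Space d → ℝ) (x : Space d) : ℝ :=
  fderiv ℝ u x (EuclideanSpace.single α 1)

/-- The Hessian `∇²σ(Ξ)` as a bilinear form. -/
def hess {d : ℕ} (σ : MinorSpace d → ℝ) (Ξ h k : MinorSpace d) : ℝ :=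
  fderiv ℝ (fderiv ℝ σ) Ξ h k

/-- Standing assumptions on the potentials: with `Σ = σ_I - σ_E`, one has `∇²Σ > 0` and
`∇Σ : ℝ^D → ℝ^D` is onto. -/
structure AdmissiblePotentials {d : ℕ} (σI σE : MinorSpace d → ℝ) : Prop where
  contDiff_I : ContDiff ℝ 2 σI
  contDiff_E : ContDiff ℝ 3 σE
  hess_pos : ∀ Ξ h : MinorSpace d, h ≠ 0 → 0 < hess (σI - σE) Ξ h h
  onto : Function.Surjective (gradient (σI - σE))

/-- `∇²σ_I ≥ γ_I 𝕀`, `γ_v 𝕀 ≥ ∇²(σ_I - σ_E) > 0` (the inequality `γ_I > γ_v` is stated where the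
constants are introduced). -/
structure ConvexityBounds {d : ℕ} (γI γv : ℝ) (σI σE : MinorSpace d → ℝ) : Prop where
  lower_I : ∀ Ξ h : MinorSpace d, γI * ‖h‖ ^ 2 ≤ hess σI Ξ h h
  upper : ∀ Ξ h : MinorSpace d, hess (σI - σE) Ξ h h ≤ γv * ‖h‖ ^ 2
  pos : ∀ Ξ h : MinorSpace d, h ≠ 0 → 0 < hess (σI - σE) Ξ h h

/-- `|∇²σ_E| ≤ M` and `|∇³σ_E| ≤ M`. -/
structure DerivativeBounds {d : ℕ} (M : ℝ) (σE : MinorSpace d → ℝ) : Prop where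
  second : ∀ Ξ : MinorSpace d, ‖iteratedFDeriv ℝ 2 σE Ξ‖ ≤ M
  third : ∀ Ξ : MinorSpace d, ‖iteratedFDeriv ℝ 3 σE Ξ‖ ≤ M

/-- The inverse map of `∇Σ`, for `Σ = σ_I - σ_E`. -/
def gradInv {d : ℕ} (σI σE : MinorSpace d → ℝ) : MinorSpace d → MinorSpace d :=
  Function.invFun (gradient (σI - σE))

/-- The integrating factor `G`: the solution of `∇G(τ) = -(∇Σ)⁻¹(-τ)` normalized by
`G(-∇Σ(Ξ)) = Ξ · ∇Σ(Ξ) - Σ(Ξ)`, given explicitly by the Legendre transformation; see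
`hasGradientAt_G` and `Psi_equilibrium` below. -/
def G {d : ℕ} (σI σE : MinorSpace d → ℝ) (τ : MinorSpace d) : ℝ :=
  -(inner ℝ (gradInv σI σE (-τ)) τ) - (σI - σE) (gradInv σI σE (-τ))

/-- The convex potential `Ψ(Ξ, τ) = σ_I(Ξ) + Ξ · τ + G(τ)`. -/
def Psi {d : ℕ} (σI σE : MinorSpace d → ℝ) (Ξ τ : MinorSpace d) : ℝ :=
  σI Ξ + inner ℝ Ξ τ + G σI σE τ

/-! ### Properties of the integrating factor -/

theorem contDiff_Sigma {d : ℕ} {σI σE : MinorSpace d → ℝ} (h : AdmissiblePotentials σI σE) :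
    ContDiff ℝ 2 (σI - σE) :=
  h.contDiff_I.sub (h.contDiff_E.of_le (by norm_num))

theorem hasStrictFDerivAt_fderiv_Sigma {d : ℕ} {σI σE : MinorSpace d → ℝ}
    (h : AdmissiblePotentials σI σE) (Ξ : MinorSpace d) :
    HasStrictFDerivAt (fderiv ℝ (σI - σE)) (fderiv ℝ (fderiv ℝ (σI - σE)) Ξ) Ξ := by
  have h1 : ContDiff ℝ 1 (fderiv ℝ (σI - σE)) :=
    (contDiff_Sigma h).fderiv_right (by norm_num)
  exact h1.contDiffAt.hasStrictFDerivAt (by norm_num)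

theorem strictMono_deriv_line {d : ℕ} {σI σE : MinorSpace d → ℝ}
    (h : AdmissiblePotentials σI σE) (Ξ k : MinorSpace d) (hk : k ≠ 0) :
    StrictMono (fun s : ℝ => fderiv ℝ (σI - σE) (Ξ + s • k) k) := by
  apply strictMono_of_hasDerivAt_pos (f' := fun s => hess (σI - σE) (Ξ + s • k) k k)
  · intro s
    have h1 := (hasStrictFDerivAt_fderiv_Sigma h (Ξ + s • k)).hasFDerivAt
    have h2 : HasDerivAt (fun s : ℝ => Ξ + s • k) k s := by
      simpa using ((hasDerivAt_id s).smul_const k).const_add Ξ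
    have h3 := h1.comp_hasDerivAt s h2
    have h4 := h3.clm_apply (hasDerivAt_const s k)
    simpa [hess] using h4
  · intro s
    exact h.hess_pos _ k hk

theorem Sigma_lower {d : ℕ} {σI σE : MinorSpace d → ℝ} (h : AdmissiblePotentials σI σE)
    (Ξ Ξ' : MinorSpace d) :
    (σI - σE) Ξ + inner ℝ (gradient (σI - σE) Ξ) (Ξ' - Ξ) ≤ (σI - σE) Ξ' := by
  rcases eq_or_ne Ξ' Ξ with rfl | hne
  · simp
  have hk : Ξ' - Ξ ≠ 0 := sub_ne_zero.mpr hne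
  have hd : ∀ s : ℝ, HasDerivAt (fun s : ℝ => (σI - σE) (Ξ + s • (Ξ' - Ξ)))
      (fderiv ℝ (σI - σE) (Ξ + s • (Ξ' - Ξ)) (Ξ' - Ξ)) s := by
    intro s
    have h1 := ((contDiff_Sigma h).differentiable (by norm_num)
      (Ξ + s • (Ξ' - Ξ))).hasFDerivAt
    have h2 : HasDerivAt (fun s : ℝ => Ξ + s • (Ξ' - Ξ)) (Ξ' - Ξ) s := by
      simpa using ((hasDerivAt_id s).smul_const (Ξ' - Ξ)).const_add Ξ
    exact h1.comp_hasDerivAt s h2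
  obtain ⟨c, hc, hceq⟩ := exists_hasDerivAt_eq_slope _ _ (zero_lt_one' ℝ)
    (fun s _ => (hd s).continuousAt.continuousWithinAt) (fun s _ => hd s)
  have hm := strictMono_deriv_line h Ξ _ hk hc.1
  simp only [one_smul, zero_smul, add_zero, add_sub_cancel, sub_zero, div_one] at hceq hm
  have hg : inner ℝ (gradient (σI - σE) Ξ) (Ξ' - Ξ) = fderiv ℝ (σI - σE) Ξ (Ξ' - Ξ) := by
    simp [gradient]
  linarith

theorem bijective_gradient_Sigma {d : ℕ} {σI σE : MinorSpace d → ℝ}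
    (h : AdmissiblePotentials σI σE) : Function.Bijective (gradient (σI - σE)) := by
  refine ⟨fun a b hab => ?_, h.onto⟩
  by_contra hne
  have hk : b - a ≠ 0 := sub_ne_zero.mpr (Ne.symm hne)
  have hm := strictMono_deriv_line h a _ hk (zero_lt_one' ℝ)
  simp only [one_smul, zero_smul, add_zero, add_sub_cancel] at hm
  have hf : fderiv ℝ (σI - σE) a = fderiv ℝ (σI - σE) b :=
    (InnerProductSpace.toDual ℝ (MinorSpace d)).symm.injective hab
  rw [hf] at hm
  exact lt_irrefl _ hm

theorem gradient_gradInv {d : ℕ} {σI σE : MinorSpace d → ℝ} (h : AdmissiblePotentials σI σE)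
    (τ : MinorSpace d) : gradient (σI - σE) (gradInv σI σE τ) = τ :=
  Function.rightInverse_invFun h.onto τ

theorem gradInv_gradient {d : ℕ} {σI σE : MinorSpace d → ℝ} (h : AdmissiblePotentials σI σE)
    (Ξ : MinorSpace d) : gradInv σI σE (gradient (σI - σE) Ξ) = Ξ :=
  Function.leftInverse_invFun (bijective_gradient_Sigma h).1 Ξ

theorem continuous_gradInv {d : ℕ} {σI σE : MinorSpace d → ℝ}
    (h : AdmissiblePotentials σI σE) : Continuous (gradInv σI σE) := by
  have hopen : IsOpenMap (gradient (σI - σE)) := by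
    rw [isOpenMap_iff_nhds_le]
    intro Ξ
    let J : StrongDual ℝ (MinorSpace d) →L[ℝ] MinorSpace d :=
      LinearMap.toContinuousLinearMap
        { toFun := fun f => (InnerProductSpace.toDual ℝ (MinorSpace d)).symm f
          map_add' := fun f g => by simp
          map_smul' := fun c f => by simp }
    have h2 : HasStrictFDerivAt (gradient (σI - σE))
        (J.comp (fderiv ℝ (fderiv ℝ (σI - σE)) Ξ)) Ξ :=
      J.hasStrictFDerivAt.comp Ξ (hasStrictFDerivAt_fderiv_Sigma h Ξ)
    have hinj : Function.Injective (J.comp (fderiv ℝ (fderiv ℝ (σI - σE)) Ξ)) := by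
      rw [injective_iff_map_eq_zero]
      intro k hk
      by_contra hne
      have h3 : fderiv ℝ (fderiv ℝ (σI - σE)) Ξ k = 0 := by
        apply (InnerProductSpace.toDual ℝ (MinorSpace d)).symm.injective
        rw [map_zero]
        exact hk
      have h4 := h.hess_pos Ξ k hne
      simp [hess, h3] at h4
    have hsurj := (LinearMap.injective_iff_surjective
      (f := (J.comp (fderiv ℝ (fderiv ℝ (σI - σE)) Ξ) :
        MinorSpace d →ₗ[ℝ] MinorSpace d))).1 hinj
    exact (h2.map_nhds_eq_of_surj (LinearMap.range_eq_top.2 hsurj)).ge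
  rw [continuous_def]
  intro s hs
  convert hopen s hs using 1
  ext τ
  constructor
  · intro hτ
    exact ⟨_, hτ, gradient_gradInv h τ⟩
  · rintro ⟨Ξ, hΞ, rfl⟩
    simpa [gradInv_gradient h] using hΞ

theorem G_lower {d : ℕ} {σI σE : MinorSpace d → ℝ} (h : AdmissiblePotentials σI σE)
    (Ξ τ : MinorSpace d) : -(inner ℝ Ξ τ) - (σI - σE) Ξ ≤ G σI σE τ := by
  have h1 := Sigma_lower h (gradInv σI σE (-τ)) Ξ
  rw [gradient_gradInv h, inner_neg_left, inner_sub_right, real_inner_comm, real_inner_comm _ τ]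
    at h1
  unfold G
  linarith

/-- `G` solves the differential system `∇G(τ) = -(∇Σ)⁻¹(-τ)`. -/
theorem hasGradientAt_G {d : ℕ} {σI σE : MinorSpace d → ℝ} (h : AdmissiblePotentials σI σE)
    (τ : MinorSpace d) : HasGradientAt (G σI σE) (-(gradInv σI σE (-τ))) τ := by
  rw [hasGradientAt_iff_isLittleO, Asymptotics.isLittleO_iff]
  intro c hc
  have hcont : Continuous (fun τ' => gradInv σI σE (-τ')) :=
    (continuous_gradInv h).comp continuous_neg
  filter_upwards [Metric.continuousAt_iff'.1 hcont.continuousAt c hc] with τ' hτ'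
  have h1 := G_lower h (gradInv σI σE (-τ)) τ'
  have h2 := G_lower h (gradInv σI σE (-τ')) τ
  have e1 : G σI σE τ = -(inner ℝ (gradInv σI σE (-τ)) τ) - (σI - σE) (gradInv σI σE (-τ)) := rfl
  have e2 : G σI σE τ' =
    -(inner ℝ (gradInv σI σE (-τ')) τ') - (σI - σE) (gradInv σI σE (-τ')) := rfl
  have h3 := abs_real_inner_le_norm (gradInv σI σE (-τ') - gradInv σI σE (-τ)) (τ' - τ)
  have h4 : ‖gradInv σI σE (-τ') - gradInv σI σE (-τ)‖ * ‖τ' - τ‖ ≤ c * ‖τ' - τ‖ := by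
    gcongr
    rw [← dist_eq_norm]
    exact hτ'.le
  have h5 := neg_abs_le (inner ℝ (gradInv σI σE (-τ') - gradInv σI σE (-τ)) (τ' - τ))
  rw [Real.norm_eq_abs, abs_le]
  simp only [inner_sub_left, inner_sub_right, inner_neg_left] at h3 h5 ⊢
  constructor <;> linarith

/-- At equilibrium `τ = -∇Σ(Ξ)` the potential `Ψ` equals `σ_E(Ξ)`. -/
theorem Psi_equilibrium {d : ℕ} {σI σE : MinorSpace d → ℝ} (h : AdmissiblePotentials σI σE)
    (Ξ : MinorSpace d) : Psi σI σE Ξ (-(gradient (σI - σE) Ξ)) = σE Ξ := by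
  simp [Psi, G, gradInv_gradient h]
  ring

/-- The internal variable `τ = T - ∇σ_I(Φ(F))`. -/
def tau {d : ℕ} (σI : MinorSpace d → ℝ) (F : Mat d) (T : MinorSpace d) : MinorSpace d :=
  T - gradient σI (Phi F)

/-- The equilibrium value `τ_∞(F) = ∇(σ_E - σ_I)(Φ(F))`. -/
def tauInf {d : ℕ} (σI σE : MinorSpace d → ℝ) (F : Mat d) : MinorSpace d :=
  gradient (σE - σI) (Phi F)

/-! ### Solutions -/

/-- On `[0, tf] × ℝ^d` the field `F` is a spatial gradient, `F_{iα} = ∂_α y_i`. -/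
def IsGradientField {d : ℕ} (tf : ℝ) (F : ℝ → Space d → Mat d) : Prop :=
  ∃ y : ℝ → Space d → Space d, ∀ t ∈ Icc 0 tf, Differentiable ℝ (y t) ∧
    ∀ x i α, F t x i α = pd α (fun z => y t z i) x

/-- `(v, F, T)` is a classical (`C¹` up to the boundary times) solution on `[0, tf] × ℝ^d` of the
stress relaxation system with relaxation parameter `ε`, and `F` is a gradient. Time derivatives at
`t = 0` and `t = tf` are one-sided. -/
structure IsRelaxationSolution {d : ℕ} (σI σE : MinorSpace d → ℝ) (ε tf : ℝ)
    (v : ℝ → Space d → Space d) (F : ℝ → Space d → Mat d)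
    (T : ℝ → Space d → MinorSpace d) : Prop where
  contDiff_v : ContDiffOn ℝ 1 (fun p : ℝ × Space d => v p.1 p.2) (Icc 0 tf ×ˢ univ)
  contDiff_F : ∀ i α,
    ContDiffOn ℝ 1 (fun p : ℝ × Space d => F p.1 p.2 i α) (Icc 0 tf ×ˢ univ)
  contDiff_T : ContDiffOn ℝ 1 (fun p : ℝ × Space d => T p.1 p.2) (Icc 0 tf ×ˢ univ)
  momentum : ∀ t ∈ Icc 0 tf, ∀ x i,
    derivWithin (fun s => v s x i) (Icc 0 tf) t
      - ∑ α, pd α (fun z => ∑ A, T t z A * dPhi (F t z) i α A) x = 0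
  kinematic : ∀ t ∈ Icc 0 tf, ∀ x i α,
    derivWithin (fun s => F s x i α) (Icc 0 tf) t - pd α (fun z => v t z i) x = 0
  relaxation : ∀ t ∈ Icc 0 tf, ∀ x A,
    derivWithin (fun s => T s x A - gradient σI (Phi (F s x)) A) (Icc 0 tf) t
      = -(1 / ε) * (T t x A - gradient σE (Phi (F t x)) A)
  curlFree : ∀ t ∈ Icc 0 tf, ∀ x i α β,
    pd β (fun z => F t z i α) x - pd α (fun z => F t z i β) x = 0
  isGradient : IsGradientField tf F

/-- `(v, F)` is a classical solution on `[0, tf] × ℝ^d` of elastodynamics with stored energy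
`σ_E ∘ Φ`, and `F` is a gradient. -/
structure IsElasticSolution {d : ℕ} (σE : MinorSpace d → ℝ) (tf : ℝ)
    (v : ℝ → Space d → Space d) (F : ℝ → Space d → Mat d) : Prop where
  contDiff_v : ContDiffOn ℝ 1 (fun p : ℝ × Space d => v p.1 p.2) (Icc 0 tf ×ˢ univ)
  contDiff_F : ∀ i α,
    ContDiffOn ℝ 1 (fun p : ℝ × Space d => F p.1 p.2 i α) (Icc 0 tf ×ˢ univ)
  momentum : ∀ t ∈ Icc 0 tf, ∀ x i,
    derivWithin (fun s => v s x i) (Icc 0 tf) t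
      - ∑ α, pd α (fun z => ∑ A, gradient σE (Phi (F t z)) A * dPhi (F t z) i α A) x = 0
  kinematic : ∀ t ∈ Icc 0 tf, ∀ x i α,
    derivWithin (fun s => F s x i α) (Icc 0 tf) t - pd α (fun z => v t z i) x = 0
  isGradient : IsGradientField tf F

/-- The scalar field `u` and its spatial gradient decay as `|x| → ∞` faster than every power of
`1 / |x|`, uniformly for `t ∈ [0, tf]`. -/
def FastDecay {d : ℕ} (tf : ℝ) (u : ℝ → Space d → ℝ) : Prop :=
  ∀ N : ℕ, ∃ K : ℝ, ∀ t ∈ Icc 0 tf, ∀ x,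
    (1 + ‖x‖) ^ N * |u t x| ≤ K ∧ (1 + ‖x‖) ^ N * ‖fderiv ℝ (u t) x‖ ≤ K

/-- `(v, F)` decays fast to the constant state `(0, F̄)`. -/
structure ElasticDecay {d : ℕ} (tf : ℝ) (Fbar : Mat d)
    (v : ℝ → Space d → Space d) (F : ℝ → Space d → Mat d) : Prop where
  decay_v : ∀ i, FastDecay tf (fun t x => v t x i)
  decay_F : ∀ i α, FastDecay tf (fun t x => F t x i α - Fbar i α)

/-- `(v, F, T)` decays fast to the constant equilibrium state `(0, F̄, ∇σ_E(Φ(F̄)))`. -/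
structure RelaxationDecay {d : ℕ} (σE : MinorSpace d → ℝ) (tf : ℝ) (Fbar : Mat d)
    (v : ℝ → Space d → Space d) (F : ℝ → Space d → Mat d)
    (T : ℝ → Space d → MinorSpace d) : Prop where
  decay_v : ∀ i, FastDecay tf (fun t x => v t x i)
  decay_F : ∀ i α, FastDecay tf (fun t x => F t x i α - Fbar i α)
  decay_T : ∀ A, FastDecay tf (fun t x => T t x A - gradient σE (Phi Fbar) A)

/-! ### Relative energy, flux, dissipation and error terms

In the following `v, F, T` and `vh, Fh` (that is, `v̂, F̂`) are values or fields of the two solutions.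
-/

/-- The relative energy density `e_r`. -/
def relEnergy {d : ℕ} (σI σE : MinorSpace d → ℝ) (v : Space d) (F : Mat d) (T : MinorSpace d)
    (vh : Space d) (Fh : Mat d) : ℝ :=
  1 / 2 * ‖v - vh‖ ^ 2 + Psi σI σE (Phi F) (T - gradient σI (Phi F)) - σE (Phi Fh)
    - ∑ A, gradient σE (Phi Fh) A * (Phi F A - Phi Fh A)

/-- The relative energy flux `f_α`. -/
def relFlux {d : ℕ} (σE : MinorSpace d → ℝ) (v : Space d) (F : Mat d) (T : MinorSpace d)
    (vh : Space d) (Fh : Mat d) (α : Fin d) : ℝ :=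
  ∑ i, ∑ A, (T A - gradient σE (Phi Fh) A) * (v i - vh i) * dPhi F i α A

/-- The dissipation `D = ∂Ψ/∂τ^A (Φ(F), T - ∇σ_I(Φ(F))) (T^A - ∂σ_E/∂Ξ^A (Φ(F)))`. -/
def dissipation {d : ℕ} (σI σE : MinorSpace d → ℝ) (F : Mat d) (T : MinorSpace d) : ℝ :=
  ∑ A, gradient (fun τ => Psi σI σE (Phi F) τ) (T - gradient σI (Phi F)) A
    * (T A - gradient σE (Phi F) A)

/-- The quadratic error `Q₁` at the point `x`. -/
def Q1 {d : ℕ} (σE : MinorSpace d → ℝ) (v : Space d → Space d) (F : Space d → Mat d)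
    (vh : Space d → Space d) (Fh : Space d → Mat d) (x : Space d) : ℝ :=
  ∑ α, ∑ i, ∑ A, pd α (fun z => gradient σE (Phi (Fh z)) A) x
    * (dPhi (F x) i α A - dPhi (Fh x) i α A) * (v x i - vh x i)

/-- The quadratic error `Q₂` at the point `x`. -/
def Q2 {d : ℕ} (σE : MinorSpace d → ℝ) (F : Space d → Mat d)
    (vh : Space d → Space d) (Fh : Space d → Mat d) (x : Space d) : ℝ :=
  ∑ α, ∑ i, ∑ A, pd α (fun z => vh z i) x * dPhi (Fh x) i α A
    * (gradient σE (Phi (F x)) A - gradient σE (Phi (Fh x)) A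
      - hess σE (Phi (Fh x)) (EuclideanSpace.single A 1) (Phi (F x) - Phi (Fh x)))

/-- The quadratic error `Q₃` at the point `x`. -/
def Q3 {d : ℕ} (σE : MinorSpace d → ℝ) (F : Space d → Mat d)
    (vh : Space d → Space d) (Fh : Space d → Mat d) (x : Space d) : ℝ :=
  ∑ α, ∑ i, ∑ A, pd α (fun z => vh z i) x
    * (gradient σE (Phi (F x)) A - gradient σE (Phi (Fh x)) A)
    * (dPhi (F x) i α A - dPhi (Fh x) i α A)

/-- The linear error `L` at the point `x`. -/
def linErr {d : ℕ} (σE : MinorSpace d → ℝ) (F : Space d → Mat d) (T : Space d → MinorSpace d)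
    (vh : Space d → Space d) (x : Space d) : ℝ :=
  ∑ α, ∑ i, ∑ A, pd α (fun z => vh z i) x
    * (T x A - gradient σE (Phi (F x)) A) * dPhi (F x) i α A

end PolyRelax

end

/-!
The relative energy splits as
`e_r = ½ |v - v̂|² + (Ψ(Ξ, τ) - σ_E(Ξ)) + (σ_E(Ξ) - σ_E(Ξ̂) - ∇σ_E(Ξ̂) · (Ξ - Ξ̂))`, with `Ξ = Φ(F)`
and `Ξ̂ = Φ(F̂)`. The second term is the Bregman divergence of the convex function `Σ = σ_I - σ_E`
between `Ξ` and `(∇Σ)⁻¹(-τ)` (`Psi_sub_eq_bregman`), and the difference of the gradients of `Σ` at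
these two points is the distance to equilibrium `T - ∇σ_E(Ξ)` (`neg_tau_eq`). As `∇²Σ ≤ γ_v`, the
gradient `∇Σ` is co-coercive, so both the second term and the dissipation are at least a multiple
of `|T - ∇σ_E(Ξ)|²`; as `∇²σ_E ≥ γ_I - γ_v`, the third term is at least a multiple of `|Ξ - Ξ̂|²`.
Altogether `e_r` controls `|v - v̂|² + |Ξ - Ξ̂|² + |T - ∇σ_E(Ξ)|²` (`relEnergy_ge`).

The relative energy identity (`relEnergy_identity`) is the chain rule together with Piola's identity
`∑_α ∂_α (∂Φ^A/∂F_{iα}(F)) = 0` for curl-free fields (`sum_pd_dPhi_eq_zero`), which is used for both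
solutions.

For the stability estimate, `∂Φ/∂F` is an affine function of `Φ` (`exists_dPhi_affine`), hence
`∂Φ/∂F(F) - ∂Φ/∂F(F̂)` is bounded by `C |Ξ - Ξ̂|`, and the errors `Q₁, Q₂, Q₃` are bounded by a
multiple of `e_r`. In the linear error `∂Φ/∂F(F)` is split in the same way: one part is again
bounded by `e_r`, with no factor `ε`, and the other one is at most `C |∇v̂| |T - ∇σ_E(Ξ)|`, which
the dissipation absorbs up to `C ε |∇v̂|²` (`exists_errors_le`). Integrated over space, where the
flux disappears because of the decay, this gives Gronwall's inequality (`integral_le_of_deriv_le`,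
`exists_stability_const`) with a constant that is uniform in all `ε > 0`. The constant depends on
bounds of `F̂`, `∇F̂` and `∇v̂` only, and `F̂` is recovered from `∇F̂` and its limit at infinity
(`exists_bound_of_gradients`). The convergence statement follows as `e_r` controls the distance of
the states.
-/

namespace PolyRelax

/-! ### Calculus of the null Lagrangians -/

theorem contDiff_det (d : ℕ) :
    ContDiff ℝ 1 (fun M : Fin d → Fin d → ℝ => (Matrix.of M).det) := by
  simp only [Matrix.det_apply, Matrix.of_apply]
  fun_prop

theorem contDiff_cof (d : ℕ) (i j : Fin d) :
    ContDiff ℝ 1 (fun M : Fin d → Fin d → ℝ => cof (Matrix.of M) i j) := by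
  simp only [cof, Matrix.transpose_apply, Matrix.adjugate_apply]
  have h : ContDiff ℝ 1 (fun M : Fin d → Fin d → ℝ =>
      (fun k l => (Matrix.of M).updateRow i (Pi.single j 1) k l)) := by
    refine contDiff_pi.2 fun k => contDiff_pi.2 fun l => ?_
    by_cases hk : k = i
    · subst hk
      simp only [Matrix.updateRow_self]
      exact contDiff_const
    · simp only [Matrix.updateRow_ne hk, Matrix.of_apply]
      fun_prop
  exact (contDiff_det d).comp h

theorem contDiff_Phi (d : ℕ) :
    ContDiff ℝ 1 (fun M : Fin d → Fin d → ℝ => Phi (Matrix.of M)) := by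
  rw [contDiff_piLp]
  rintro (p | p | p)
  · simp only [Phi, Sum.elim_inl, Matrix.of_apply]
    fun_prop
  · exact contDiff_cof d _ _
  · exact contDiff_det d

theorem dPhi_eq_fderiv {d : ℕ} (F : Mat d) (i α : Fin d) :
    dPhi F i α = fderiv ℝ (fun M : Fin d → Fin d → ℝ => Phi (Matrix.of M)) (fun i α => F i α)
      (fun j β => Matrix.single i α (1 : ℝ) j β) := by
  have h := ((contDiff_Phi d).differentiable (by norm_num) (fun i α => F i α)).hasFDerivAt
  exact (h.hasLineDerivAt (fun j β => Matrix.single i α (1 : ℝ) j β)).lineDeriv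

theorem fderiv_Phi_apply {d : ℕ} (F : Mat d) (X : Fin d → Fin d → ℝ) :
    fderiv ℝ (fun M : Fin d → Fin d → ℝ => Phi (Matrix.of M)) (fun i α => F i α) X
      = ∑ i, ∑ α, X i α • dPhi F i α := by
  have hX : X = ∑ i, ∑ α, X i α • (fun j β => Matrix.single i α (1 : ℝ) j β) := by
    funext j β
    simp [Finset.sum_apply, Matrix.single_apply, ite_and]
  conv_lhs => rw [hX]
  simp only [map_sum, map_smul, dPhi_eq_fderiv]

/-- Chain rule for the null Lagrangians, for a field of matrices with differentiable entries. -/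
theorem hasFDerivWithinAt_Phi {d : ℕ} {E : Type*} [NormedAddCommGroup E] [NormedSpace ℝ E]
    {u : E → Mat d} {u' : Fin d → Fin d → (E →L[ℝ] ℝ)} {s : Set E} {x : E}
    (h : ∀ i α, HasFDerivWithinAt (fun z => u z i α) (u' i α) s x) :
    HasFDerivWithinAt (fun z => Phi (u z))
      (∑ i, ∑ α, (u' i α).smulRight (dPhi (u x) i α)) s x := by
  have h1 : HasFDerivWithinAt (fun z => (fun i α => u z i α))
      (ContinuousLinearMap.pi fun i => ContinuousLinearMap.pi fun α => u' i α) s x := by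
    rw [hasFDerivWithinAt_pi]
    intro i
    rw [hasFDerivWithinAt_pi]
    exact fun α => h i α
  have h2 := ((contDiff_Phi d).differentiable (by norm_num) (fun i α => u x i α)).hasFDerivAt
  refine (h2.comp_hasFDerivWithinAt x h1).congr_fderiv ?_
  ext1 y
  rw [ContinuousLinearMap.comp_apply, fderiv_Phi_apply]
  simp

theorem Phi_two_apply (F : Mat 2) (u : Unit) :
    Phi F (Sum.inr (Sum.inr u)) = F 0 0 * F 1 1 - F 0 1 * F 1 0 := by
  simp [Phi, Matrix.det_fin_two]

/-- With indices counted cyclically, the entries of the cofactor matrix carry no sign. -/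
theorem cof_three (F : Mat 3) (j β : Fin 3) :
    cof F j β = F (j + 1) (β + 1) * F (j + 2) (β + 2) - F (j + 1) (β + 2) * F (j + 2) (β + 1) := by
  fin_cases j <;> fin_cases β <;> simp [cof, Matrix.adjugate_fin_three] <;> ring_nf

theorem hasLineDerivAt_entry {d : ℕ} (F : Mat d) (i α j β : Fin d) :
    HasDerivAt (fun t : ℝ => (F + t • Matrix.single i α (1 : ℝ)) j β)
      (Matrix.single i α (1 : ℝ) j β) 0 := by
  exact (((hasDerivAt_id (0 : ℝ)).mul_const (Matrix.single i α (1 : ℝ) j β)).const_add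
    (F j β)).congr_deriv (one_mul _)

/-- The components of `dPhi` are computed by differentiating along a line. -/
theorem dPhi_apply {d : ℕ} (F : Mat d) (i α : Fin d) (A : MinorIdx d) {c : ℝ}
    (h : HasDerivAt (fun t : ℝ => Phi (F + t • Matrix.single i α (1 : ℝ)) A) c 0) :
    dPhi F i α A = c := by
  have h1 := ((contDiff_Phi d).differentiable (by norm_num) (fun i α => F i α)).hasFDerivAt
  have h2 := h1.hasLineDerivAt (fun j β => Matrix.single i α (1 : ℝ) j β)
  have h3 := (EuclideanSpace.proj (𝕜 := ℝ) A).hasFDerivAt.comp_hasDerivAt (0 : ℝ) h2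
  rw [dPhi_eq_fderiv]
  exact h3.unique h

theorem dPhi_entry {d : ℕ} (F : Mat d) (i α : Fin d) (p : Fin d × Fin d) :
    dPhi F i α (Sum.inl p) = Matrix.single i α (1 : ℝ) p.1 p.2 :=
  dPhi_apply F i α _ (hasLineDerivAt_entry F i α p.1 p.2)

theorem dPhi_two_det (F : Mat 2) (i α : Fin 2) (u : Unit) :
    dPhi F i α (Sum.inr (Sum.inr u)) =
      (Matrix.single i α (1 : ℝ) 0 0 * F 1 1 + F 0 0 * Matrix.single i α (1 : ℝ) 1 1)
      - (Matrix.single i α (1 : ℝ) 0 1 * F 1 0 + F 0 1 * Matrix.single i α (1 : ℝ) 1 0) := by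
  apply dPhi_apply
  simp only [Phi_two_apply]
  have e := hasLineDerivAt_entry F i α
  convert! ((e 0 0).mul (e 1 1)).sub ((e 0 1).mul (e 1 0)) using 1
  simp

theorem dPhi_three_cof (F : Mat 3) (i α : Fin 3) (p : {_p : Fin 3 × Fin 3 // 3 = 3}) :
    dPhi F i α (Sum.inr (Sum.inl p)) =
      (Matrix.single i α (1 : ℝ) (p.1.1 + 1) (p.1.2 + 1) * F (p.1.1 + 2) (p.1.2 + 2)
        + F (p.1.1 + 1) (p.1.2 + 1) * Matrix.single i α (1 : ℝ) (p.1.1 + 2) (p.1.2 + 2))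
      - (Matrix.single i α (1 : ℝ) (p.1.1 + 1) (p.1.2 + 2) * F (p.1.1 + 2) (p.1.2 + 1)
        + F (p.1.1 + 1) (p.1.2 + 2) * Matrix.single i α (1 : ℝ) (p.1.1 + 2) (p.1.2 + 1)) := by
  apply dPhi_apply
  simp only [Phi, Sum.elim_inr, Sum.elim_inl, cof_three]
  have e := hasLineDerivAt_entry F i α
  convert! ((e (p.1.1 + 1) (p.1.2 + 1)).mul (e (p.1.1 + 2) (p.1.2 + 2))).sub
    ((e (p.1.1 + 1) (p.1.2 + 2)).mul (e (p.1.1 + 2) (p.1.2 + 1))) using 1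
  simp

theorem dPhi_three_det (F : Mat 3) (i α : Fin 3) (u : Unit) :
    dPhi F i α (Sum.inr (Sum.inr u)) = cof F i α := by
  apply dPhi_apply
  simp only [Phi, Sum.elim_inr]
  simp only [Matrix.det_fin_three]
  have e := hasLineDerivAt_entry F i α
  convert! ((((((e 0 0).mul (e 1 1)).mul (e 2 2)).sub (((e 0 0).mul (e 1 2)).mul (e 2 1))).sub
    (((e 0 1).mul (e 1 0)).mul (e 2 2))).add (((e 0 1).mul (e 1 2)).mul (e 2 0))).add
    (((e 0 2).mul (e 1 0)).mul (e 2 1)) |>.sub (((e 0 2).mul (e 1 1)).mul (e 2 0)) using 1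
  rw [cof_three]
  fin_cases i <;> fin_cases α <;> simp <;> ring


/-- The derivative of the null Lagrangians is an affine function of the null Lagrangians
themselves. -/
theorem exists_dPhi_affine {d : ℕ} (hd : d = 2 ∨ d = 3) :
    ∃ (a : Fin d → Fin d → MinorIdx d → ℝ)
      (ℓ : Fin d → Fin d → MinorIdx d → (MinorSpace d →L[ℝ] ℝ)),
      ∀ (F : Mat d) (i α : Fin d) (A : MinorIdx d), dPhi F i α A = a i α A + ℓ i α A (Phi F) := by
  suffices h : ∀ (i α : Fin d) (A : MinorIdx d), ∃ (a : ℝ) (ℓ : MinorSpace d →L[ℝ] ℝ),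
      ∀ F : Mat d, dPhi F i α A = a + ℓ (Phi F) by
    choose a ℓ h using h
    exact ⟨a, ℓ, fun F i α A => h i α A F⟩
  intro i α A
  have hproj : ∀ (F : Mat d) (j β : Fin d),
      EuclideanSpace.proj (𝕜 := ℝ) (Sum.inl (j, β) : MinorIdx d) (Phi F) = F j β :=
    fun F j β => rfl
  rcases A with p | p | u
  · exact ⟨Matrix.single i α (1 : ℝ) p.1 p.2, 0, fun F => by rw [dPhi_entry]; simp⟩
  · have h3 : d = 3 := p.2
    subst h3
    refine ⟨0, (Matrix.single i α (1 : ℝ) (p.1.1 + 1) (p.1.2 + 1) •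
        EuclideanSpace.proj (Sum.inl (p.1.1 + 2, p.1.2 + 2) : MinorIdx 3)
      + Matrix.single i α (1 : ℝ) (p.1.1 + 2) (p.1.2 + 2) •
        EuclideanSpace.proj (Sum.inl (p.1.1 + 1, p.1.2 + 1) : MinorIdx 3))
      - (Matrix.single i α (1 : ℝ) (p.1.1 + 1) (p.1.2 + 2) •
        EuclideanSpace.proj (Sum.inl (p.1.1 + 2, p.1.2 + 1) : MinorIdx 3)
      + Matrix.single i α (1 : ℝ) (p.1.1 + 2) (p.1.2 + 1) •
        EuclideanSpace.proj (Sum.inl (p.1.1 + 1, p.1.2 + 2) : MinorIdx 3)), fun F => ?_⟩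
    rw [dPhi_three_cof]
    simp only [sub_apply, add_apply,
      smul_apply, hproj, smul_eq_mul]
    ring
  · rcases hd with rfl | rfl
    · refine ⟨0, (Matrix.single i α (1 : ℝ) 0 0 •
          EuclideanSpace.proj (Sum.inl (1, 1) : MinorIdx 2)
        + Matrix.single i α (1 : ℝ) 1 1 • EuclideanSpace.proj (Sum.inl (0, 0) : MinorIdx 2))
        - (Matrix.single i α (1 : ℝ) 0 1 • EuclideanSpace.proj (Sum.inl (1, 0) : MinorIdx 2)
        + Matrix.single i α (1 : ℝ) 1 0 • EuclideanSpace.proj (Sum.inl (0, 1) : MinorIdx 2)),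
        fun F => ?_⟩
      rw [dPhi_two_det]
      simp only [sub_apply, add_apply,
        smul_apply, hproj, smul_eq_mul]
      ring
    · refine ⟨0, EuclideanSpace.proj (Sum.inr (Sum.inl ⟨(i, α), rfl⟩) : MinorIdx 3), fun F => ?_⟩
      rw [dPhi_three_det, zero_add]
      rfl

theorem pd_add {d : ℕ} {α : Fin d} {u w : Space d → ℝ} {x : Space d}
    (hu : DifferentiableAt ℝ u x) (hw : DifferentiableAt ℝ w x) :
    pd α (fun z => u z + w z) x = pd α u x + pd α w x := by
  simp only [pd]
  rw [fderiv_fun_add hu hw]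
  rfl

theorem pd_sub {d : ℕ} {α : Fin d} {u w : Space d → ℝ} {x : Space d}
    (hu : DifferentiableAt ℝ u x) (hw : DifferentiableAt ℝ w x) :
    pd α (fun z => u z - w z) x = pd α u x - pd α w x := by
  simp only [pd]
  rw [fderiv_fun_sub hu hw]
  rfl

theorem pd_mul {d : ℕ} {α : Fin d} {u w : Space d → ℝ} {x : Space d}
    (hu : DifferentiableAt ℝ u x) (hw : DifferentiableAt ℝ w x) :
    pd α (fun z => u z * w z) x = pd α u x * w x + u x * pd α w x := by
  simp only [pd]
  rw [fderiv_fun_mul hu hw]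
  simp
  ring

theorem pd_const {d : ℕ} {α : Fin d} (c : ℝ) (x : Space d) : pd α (fun _ => c) x = 0 := by
  simp [pd]

theorem pd_sum {d : ℕ} {ι : Type*} (s : Finset ι) {α : Fin d} {u : ι → Space d → ℝ} {x : Space d}
    (hu : ∀ i ∈ s, DifferentiableAt ℝ (u i) x) :
    pd α (fun z => ∑ i ∈ s, u i z) x = ∑ i ∈ s, pd α (u i) x := by
  simp only [pd]
  rw [fderiv_fun_sum hu]
  simp

/-- Piola's identity: along a curl-free field of matrices the derivative of a null Lagrangian is
divergence free. -/
theorem sum_pd_dPhi_eq_zero {d : ℕ} (hd : d = 2 ∨ d = 3) {u : Space d → Mat d} {x : Space d}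
    (hu : ∀ i α, DifferentiableAt ℝ (fun z => u z i α) x)
    (hcurl : ∀ i α β, pd β (fun z => u z i α) x = pd α (fun z => u z i β) x)
    (i : Fin d) (A : MinorIdx d) :
    ∑ α, pd α (fun z => dPhi (u z) i α A) x = 0 := by
  have hc : ∀ (c : ℝ) (i α), DifferentiableAt ℝ (fun z => c * u z i α) x :=
    fun c i α => (hu i α).const_mul c
  have hpc : ∀ (c : ℝ) (β i α), pd β (fun z => c * u z i α) x = c * pd β (fun z => u z i α) x := by
    intro c β i α
    rw [pd_mul (differentiableAt_const c) (hu i α), pd_const]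
    ring
  have hcr : ∀ (c : ℝ) (i α), DifferentiableAt ℝ (fun z => u z i α * c) x :=
    fun c i α => (hu i α).mul_const c
  have hpcr : ∀ (c : ℝ) (β i α), pd β (fun z => u z i α * c) x = pd β (fun z => u z i α) x * c := by
    intro c β i α
    rw [pd_mul (hu i α) (differentiableAt_const c), pd_const]
    ring
  rcases A with p | p | w
  · simp only [dPhi_entry, pd_const, Finset.sum_const_zero]
  · have h3 : d = 3 := p.2
    subst h3
    have key : ∀ α : Fin 3, pd α (fun z => dPhi (u z) i α (Sum.inr (Sum.inl p))) x =
        (Matrix.single i α (1 : ℝ) (p.1.1 + 1) (p.1.2 + 1) *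
            pd α (fun z => u z (p.1.1 + 2) (p.1.2 + 2)) x
          + pd α (fun z => u z (p.1.1 + 1) (p.1.2 + 1)) x *
            Matrix.single i α (1 : ℝ) (p.1.1 + 2) (p.1.2 + 2))
        - (Matrix.single i α (1 : ℝ) (p.1.1 + 1) (p.1.2 + 2) *
            pd α (fun z => u z (p.1.1 + 2) (p.1.2 + 1)) x
          + pd α (fun z => u z (p.1.1 + 1) (p.1.2 + 2)) x *
            Matrix.single i α (1 : ℝ) (p.1.1 + 2) (p.1.2 + 1)) := by
      intro α
      simp only [dPhi_three_cof]
      rw [pd_sub ((hc _ _ _).fun_add (hcr _ _ _)) ((hc _ _ _).fun_add (hcr _ _ _)),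
        pd_add (hc _ _ _) (hcr _ _ _), pd_add (hc _ _ _) (hcr _ _ _), hpc, hpc, hpcr, hpcr]
    simp only [key, Matrix.single_apply]
    rw [Finset.sum_sub_distrib, Finset.sum_add_distrib, Finset.sum_add_distrib]
    simp only [ite_and, ite_mul, mul_ite, one_mul, mul_one, zero_mul, mul_zero]
    by_cases h1 : i = p.1.1 + 1 <;> by_cases h2 : i = p.1.1 + 2 <;>
      simp [h1, h2, hcurl _ (p.1.2 + 1) (p.1.2 + 2)]
  · rcases hd with rfl | rfl
    · have key : ∀ α : Fin 2, pd α (fun z => dPhi (u z) i α (Sum.inr (Sum.inr w))) x =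
          (Matrix.single i α (1 : ℝ) 0 0 * pd α (fun z => u z 1 1) x
            + pd α (fun z => u z 0 0) x * Matrix.single i α (1 : ℝ) 1 1)
          - (Matrix.single i α (1 : ℝ) 0 1 * pd α (fun z => u z 1 0) x
            + pd α (fun z => u z 0 1) x * Matrix.single i α (1 : ℝ) 1 0) := by
        intro α
        simp only [dPhi_two_det]
        rw [pd_sub ((hc _ _ _).fun_add (hcr _ _ _)) ((hc _ _ _).fun_add (hcr _ _ _)),
          pd_add (hc _ _ _) (hcr _ _ _), pd_add (hc _ _ _) (hcr _ _ _), hpc, hpc, hpcr, hpcr]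
      simp only [key, Fin.sum_univ_two, Matrix.single_apply]
      fin_cases i <;> simp [hcurl _ 0 1]
    · have key : ∀ α : Fin 3, pd α (fun z => dPhi (u z) i α (Sum.inr (Sum.inr w))) x =
          (pd α (fun z => u z (i + 1) (α + 1)) x * u x (i + 2) (α + 2)
            + u x (i + 1) (α + 1) * pd α (fun z => u z (i + 2) (α + 2)) x)
          - (pd α (fun z => u z (i + 1) (α + 2)) x * u x (i + 2) (α + 1)
            + u x (i + 1) (α + 2) * pd α (fun z => u z (i + 2) (α + 1)) x) := by
        intro α
        simp only [dPhi_three_det, cof_three]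
        rw [pd_sub ((hu _ _).fun_mul (hu _ _)) ((hu _ _).fun_mul (hu _ _)),
          pd_mul (hu _ _) (hu _ _), pd_mul (hu _ _) (hu _ _)]
      have e : (1 : Fin 3) + 1 = 2 ∧ (1 : Fin 3) + 2 = 0 ∧ (2 : Fin 3) + 1 = 0 ∧
        (2 : Fin 3) + 2 = 1 := by decide
      simp only [key, Fin.sum_univ_three, zero_add, e.1, e.2.1, e.2.2.1, e.2.2.2]
      rw [hcurl (i + 1) 1 0, hcurl (i + 1) 2 0, hcurl (i + 1) 2 1, hcurl (i + 2) 1 0,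
        hcurl (i + 2) 2 0, hcurl (i + 2) 2 1]
      ring

/-! ### Convexity and the relative energy -/

theorem inner_gradient {d : ℕ} (σ : MinorSpace d → ℝ) (Ξ h : MinorSpace d) :
    inner ℝ (gradient σ Ξ) h = fderiv ℝ σ Ξ h := by
  simp [gradient]

theorem gradient_apply {d : ℕ} (σ : MinorSpace d → ℝ) (Ξ : MinorSpace d) (A : MinorIdx d) :
    gradient σ Ξ A = fderiv ℝ σ Ξ (EuclideanSpace.single A 1) := by
  rw [← inner_gradient, EuclideanSpace.inner_single_right]
  simp

theorem sum_mul_eq_inner {ι : Type*} [Fintype ι] (a b : EuclideanSpace ℝ ι) :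
    ∑ A, a A * b A = inner ℝ a b := by
  simp [PiLp.inner_apply, mul_comm]

theorem norm_gradient_sub {d : ℕ} (σ : MinorSpace d → ℝ) (Ξ Ξ' : MinorSpace d) :
    ‖gradient σ Ξ - gradient σ Ξ'‖ = ‖fderiv ℝ σ Ξ - fderiv ℝ σ Ξ'‖ := by
  simp only [gradient]
  rw [← map_sub, LinearIsometryEquiv.norm_map]

theorem hasFDerivAt_fderiv_of_contDiff {E : Type*} [NormedAddCommGroup E] [NormedSpace ℝ E]
    {σ : E → ℝ} (h : ContDiff ℝ 2 σ) (Ξ : E) :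
    HasFDerivAt (fderiv ℝ σ) (fderiv ℝ (fderiv ℝ σ) Ξ) Ξ :=
  ((h.fderiv_right (m := 1) (by norm_num)).differentiable (by norm_num) Ξ).hasFDerivAt

theorem hasDerivAt_segment {E : Type*} [NormedAddCommGroup E] [NormedSpace ℝ E] (Ξ k : E) (s : ℝ) :
    HasDerivAt (fun s : ℝ => Ξ + s • k) k s := by
  simpa using ((hasDerivAt_id s).smul_const k).const_add Ξ

/-- A lower bound of the Hessian gives a lower bound of the Taylor remainder of first order. -/
theorem taylor_lower {d : ℕ} {σ : MinorSpace d → ℝ} (h : ContDiff ℝ 2 σ) {m : ℝ}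
    (hm : ∀ Ξ k : MinorSpace d, m * ‖k‖ ^ 2 ≤ hess σ Ξ k k) (Ξ Ξ' : MinorSpace d) :
    m / 2 * ‖Ξ' - Ξ‖ ^ 2 ≤ σ Ξ' - σ Ξ - fderiv ℝ σ Ξ (Ξ' - Ξ) := by
  set k := Ξ' - Ξ with hk
  have hd1 : ∀ s : ℝ, HasDerivAt (fun s : ℝ => fderiv ℝ σ (Ξ + s • k) k - m * ‖k‖ ^ 2 * s)
      (hess σ (Ξ + s • k) k k - m * ‖k‖ ^ 2) s := by
    intro s
    have h1 := (hasFDerivAt_fderiv_of_contDiff h (Ξ + s • k)).comp_hasDerivAt s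
      (hasDerivAt_segment Ξ k s)
    have h2 := h1.clm_apply (hasDerivAt_const s k)
    refine (h2.sub ((hasDerivAt_id s).const_mul (m * ‖k‖ ^ 2))).congr_deriv ?_
    simp [hess]
  have hmono : Monotone (fun s : ℝ => fderiv ℝ σ (Ξ + s • k) k - m * ‖k‖ ^ 2 * s) :=
    monotone_of_hasDerivAt_nonneg hd1 fun s => sub_nonneg.2 (hm _ _)
  have hd2 : ∀ s : ℝ, HasDerivAt
      (fun s : ℝ => σ (Ξ + s • k) - m / 2 * ‖k‖ ^ 2 * s ^ 2 - s * fderiv ℝ σ Ξ k)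
      (fderiv ℝ σ (Ξ + s • k) k - m * ‖k‖ ^ 2 * s - fderiv ℝ σ Ξ k) s := by
    intro s
    have h1 := (h.differentiable (by norm_num) (Ξ + s • k)).hasFDerivAt.comp_hasDerivAt s
      (hasDerivAt_segment Ξ k s)
    have h2 := (h1.sub (((hasDerivAt_id s).pow 2).const_mul (m / 2 * ‖k‖ ^ 2))).sub
      ((hasDerivAt_id s).mul_const (fderiv ℝ σ Ξ k))
    refine h2.congr_deriv ?_
    simp only [id, one_mul, mul_one]
    norm_num
    ring
  have hmono2 : MonotoneOn
      (fun s : ℝ => σ (Ξ + s • k) - m / 2 * ‖k‖ ^ 2 * s ^ 2 - s * fderiv ℝ σ Ξ k) (Icc 0 1) := by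
    refine monotoneOn_of_hasDerivWithinAt_nonneg (convex_Icc 0 1)
      (fun s _ => (hd2 s).continuousAt.continuousWithinAt)
      (fun s _ => (hd2 s).hasDerivWithinAt) ?_
    intro s hs
    rw [interior_Icc] at hs
    have := hmono hs.1.le
    simp only [zero_smul, add_zero, mul_zero, sub_zero] at this
    linarith
  have := hmono2 (left_mem_Icc.2 zero_le_one) (right_mem_Icc.2 zero_le_one) zero_le_one
  simp only [zero_smul, add_zero, one_smul, one_mul, zero_mul, sub_zero, hk, add_sub_cancel] at this
  rw [hk]
  linarith

theorem hess_neg {d : ℕ} (σ : MinorSpace d → ℝ) (Ξ h k : MinorSpace d) :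
    hess (-σ) Ξ h k = -hess σ Ξ h k := by
  have h1 : fderiv ℝ (-σ) = -fderiv ℝ σ := by
    funext x
    exact fderiv_neg
  simp only [hess]
  rw [h1, fderiv_neg]
  simp

theorem taylor_upper {d : ℕ} {σ : MinorSpace d → ℝ} (h : ContDiff ℝ 2 σ) {m : ℝ}
    (hm : ∀ Ξ k : MinorSpace d, hess σ Ξ k k ≤ m * ‖k‖ ^ 2) (Ξ Ξ' : MinorSpace d) :
    σ Ξ' - σ Ξ - fderiv ℝ σ Ξ (Ξ' - Ξ) ≤ m / 2 * ‖Ξ' - Ξ‖ ^ 2 := by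
  have h1 := taylor_lower (σ := -σ) h.neg (m := -m)
    (fun Ξ k => by rw [hess_neg]; linarith [hm Ξ k]) Ξ Ξ'
  rw [fderiv_neg] at h1
  simp only [Pi.neg_apply, neg_apply] at h1
  linarith

theorem hess_sub {d : ℕ} {σI σE : MinorSpace d → ℝ} (hI : ContDiff ℝ 2 σI) (hE : ContDiff ℝ 2 σE)
    (Ξ h k : MinorSpace d) : hess (σI - σE) Ξ h k = hess σI Ξ h k - hess σE Ξ h k := by
  have h1 : fderiv ℝ (σI - σE) = fderiv ℝ σI - fderiv ℝ σE := by
    funext x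
    exact fderiv_sub (hI.differentiable (by norm_num) x) (hE.differentiable (by norm_num) x)
  simp only [hess]
  rw [h1, fderiv_sub (hasFDerivAt_fderiv_of_contDiff hI Ξ).differentiableAt
    (hasFDerivAt_fderiv_of_contDiff hE Ξ).differentiableAt]
  simp

section Cocoercive

variable {d : ℕ} {S : MinorSpace d → ℝ} {γ : ℝ}

/-- Co-coercivity of the gradient of a convex function whose Hessian is at most `γ`, in the form of
a lower bound for the Bregman divergence. -/
theorem norm_gradient_sub_sq_le_bregman (hS : ContDiff ℝ 2 S) (hγ : 0 < γ)
    (h0 : ∀ Ξ k : MinorSpace d, 0 ≤ hess S Ξ k k)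
    (hu : ∀ Ξ k : MinorSpace d, hess S Ξ k k ≤ γ * ‖k‖ ^ 2) (Ξ Ξ' : MinorSpace d) :
    1 / (2 * γ) * ‖gradient S Ξ - gradient S Ξ'‖ ^ 2
      ≤ S Ξ - S Ξ' - inner ℝ (gradient S Ξ') (Ξ - Ξ') := by
  set p := gradient S Ξ - gradient S Ξ' with hp
  -- compare the values at `Ξ` and `Ξ'` through the point `Ξ - p / γ`, which minimizes the quadratic
  -- upper bound at `Ξ` after subtraction of the tangent at `Ξ'`
  have h1 := taylor_lower hS (m := 0) (fun Ξ k => by simpa using h0 Ξ k) Ξ' (Ξ - (1 / γ) • p)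
  have h2 := taylor_upper hS hu Ξ (Ξ - (1 / γ) • p)
  rw [← inner_gradient] at h1 h2
  have e1 : Ξ - (1 / γ) • p - Ξ = -((1 / γ) • p) := by abel
  have e2 : Ξ - (1 / γ) • p - Ξ' = (Ξ - Ξ') - (1 / γ) • p := by abel
  rw [e1, norm_neg, norm_smul, inner_neg_right, real_inner_smul_right] at h2
  rw [e2, inner_sub_right, real_inner_smul_right] at h1
  have e3 : inner ℝ (gradient S Ξ) p - inner ℝ (gradient S Ξ') p = ‖p‖ ^ 2 := by
    rw [← inner_sub_left, ← hp, real_inner_self_eq_norm_sq]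
  have e4 : γ / 2 * (‖1 / γ‖ * ‖p‖) ^ 2 = 1 / (2 * γ) * ‖p‖ ^ 2 := by
    rw [Real.norm_of_nonneg (by positivity)]
    field_simp
  have e5 : 1 / γ * inner ℝ (gradient S Ξ) p - 1 / γ * inner ℝ (gradient S Ξ') p
      = 2 * (1 / (2 * γ) * ‖p‖ ^ 2) := by
    rw [← mul_sub, e3]
    field_simp
  rw [e4] at h2
  simp only [zero_div, zero_mul] at h1
  linarith

theorem norm_gradient_sub_sq_le_inner (hS : ContDiff ℝ 2 S) (hγ : 0 < γ)
    (h0 : ∀ Ξ k : MinorSpace d, 0 ≤ hess S Ξ k k)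
    (hu : ∀ Ξ k : MinorSpace d, hess S Ξ k k ≤ γ * ‖k‖ ^ 2) (Ξ Ξ' : MinorSpace d) :
    1 / γ * ‖gradient S Ξ - gradient S Ξ'‖ ^ 2
      ≤ inner ℝ (Ξ - Ξ') (gradient S Ξ - gradient S Ξ') := by
  have h1 := norm_gradient_sub_sq_le_bregman hS hγ h0 hu Ξ Ξ'
  have h2 := norm_gradient_sub_sq_le_bregman hS hγ h0 hu Ξ' Ξ
  rw [norm_sub_rev, ← neg_sub Ξ Ξ', inner_neg_right] at h2
  rw [real_inner_comm, inner_sub_left]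
  have : 1 / γ * ‖gradient S Ξ - gradient S Ξ'‖ ^ 2 =
    2 * (1 / (2 * γ) * ‖gradient S Ξ - gradient S Ξ'‖ ^ 2) := by field_simp
  linarith

theorem norm_gradient_sub_le (hS : ContDiff ℝ 2 S) (hγ : 0 < γ)
    (h0 : ∀ Ξ k : MinorSpace d, 0 ≤ hess S Ξ k k)
    (hu : ∀ Ξ k : MinorSpace d, hess S Ξ k k ≤ γ * ‖k‖ ^ 2) (Ξ Ξ' : MinorSpace d) :
    ‖gradient S Ξ - gradient S Ξ'‖ ≤ γ * ‖Ξ - Ξ'‖ := by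
  have h1 := norm_gradient_sub_sq_le_inner hS hγ h0 hu Ξ Ξ'
  have h2 := real_inner_le_norm (Ξ - Ξ') (gradient S Ξ - gradient S Ξ')
  rcases (norm_nonneg (gradient S Ξ - gradient S Ξ')).eq_or_lt with h3 | h3
  · rw [← h3]
    positivity
  · have h4 := h1.trans h2
    rw [sq, ← mul_assoc] at h4
    have h5 := le_of_mul_le_mul_right h4 h3
    rwa [one_div, inv_mul_le_iff₀ hγ] at h5

end Cocoercive

section Bounds

variable {d : ℕ} {σE : MinorSpace d → ℝ} {M : ℝ}

theorem norm_fderiv_fderiv_eq {E F : Type*} [NormedAddCommGroup E] [NormedSpace ℝ E]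
    [NormedAddCommGroup F] [NormedSpace ℝ F] (f : E → F) (x : E) :
    ‖fderiv ℝ (fderiv ℝ f) x‖ = ‖iteratedFDeriv ℝ 2 f x‖ := by
  rw [← norm_iteratedFDeriv_fderiv, norm_iteratedFDeriv_one]

theorem norm_fderiv_sub_le {E F : Type*} [NormedAddCommGroup E] [NormedSpace ℝ E]
    [NormedAddCommGroup F] [NormedSpace ℝ F] {f : E → F} (hf : ContDiff ℝ 2 f) {M : ℝ}
    (hM : ∀ x, ‖iteratedFDeriv ℝ 2 f x‖ ≤ M) (x y : E) :
    ‖fderiv ℝ f x - fderiv ℝ f y‖ ≤ M * ‖x - y‖ :=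
  convex_univ.norm_image_sub_le_of_norm_fderiv_le (𝕜 := ℝ)
    (fun z _ => (hf.fderiv_right (m := 1) (by norm_num)).differentiable (by norm_num) z)
    (fun z _ => (norm_fderiv_fderiv_eq f z).trans_le (hM z)) (mem_univ _) (mem_univ _)

theorem norm_taylor_le {E F : Type*} [NormedAddCommGroup E] [NormedSpace ℝ E]
    [NormedAddCommGroup F] [NormedSpace ℝ F] {f : E → F} (hf : ContDiff ℝ 2 f) {M : ℝ}
    (hM : ∀ x, ‖iteratedFDeriv ℝ 2 f x‖ ≤ M) (x y : E) :
    ‖f x - f y - fderiv ℝ f y (x - y)‖ ≤ M * ‖x - y‖ ^ 2 := by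
  have hM0 : 0 ≤ M := (norm_nonneg _).trans (hM x)
  have := (convex_closedBall y ‖x - y‖).norm_image_sub_le_of_norm_hasFDerivWithin_le'
    (f := f) (f' := fderiv ℝ f) (φ := fderiv ℝ f y) (C := M * ‖x - y‖) (x := y) (y := x)
    (fun z _ => (hf.differentiable (by norm_num) z).hasFDerivAt.hasFDerivWithinAt)
    (fun z hz => (norm_fderiv_sub_le hf hM z y).trans (by
      rw [mem_closedBall_iff_norm] at hz
      gcongr)) (Metric.mem_closedBall_self (norm_nonneg _)) (by simp [dist_eq_norm])
  rwa [mul_assoc, ← sq] at this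

theorem norm_gradient_sub_le_of_bounds (hE : ContDiff ℝ 3 σE) (hM : DerivativeBounds M σE)
    (Ξ Ξ' : MinorSpace d) : ‖gradient σE Ξ - gradient σE Ξ'‖ ≤ M * ‖Ξ - Ξ'‖ := by
  rw [norm_gradient_sub]
  exact norm_fderiv_sub_le (hE.of_le (by norm_num)) hM.second Ξ Ξ'

theorem abs_hess_le (hM : DerivativeBounds M σE) (Ξ h k : MinorSpace d) :
    |hess σE Ξ h k| ≤ M * ‖h‖ * ‖k‖ :=
  ((fderiv ℝ (fderiv ℝ σE) Ξ).le_opNorm₂ h k).trans <| by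
    gcongr
    exact (norm_fderiv_fderiv_eq σE Ξ).trans_le (hM.second Ξ)

/-- The second order Taylor remainder of `∇σ_E` is quadratic. -/
theorem norm_taylor_gradient_le (hE : ContDiff ℝ 3 σE) (hM : DerivativeBounds M σE)
    (Ξ Ξ' : MinorSpace d) :
    ‖fderiv ℝ σE Ξ - fderiv ℝ σE Ξ' - fderiv ℝ (fderiv ℝ σE) Ξ' (Ξ - Ξ')‖
      ≤ M * ‖Ξ - Ξ'‖ ^ 2 := by
  refine norm_taylor_le (hE.fderiv_right (m := 2) (by norm_num)) (fun x => ?_) Ξ Ξ'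
  rw [norm_iteratedFDeriv_fderiv]
  exact hM.third x

end Bounds

section Gap

variable {d : ℕ} {σI σE : MinorSpace d → ℝ}

/-- The distance of `Ψ` to equilibrium is a Bregman divergence of `Σ = σ_I - σ_E`. -/
theorem Psi_sub_eq_bregman (h : AdmissiblePotentials σI σE) (Ξ τ : MinorSpace d) :
    Psi σI σE Ξ τ - σE Ξ = (σI - σE) Ξ - (σI - σE) (gradInv σI σE (-τ))
      - inner ℝ (gradient (σI - σE) (gradInv σI σE (-τ))) (Ξ - gradInv σI σE (-τ)) := by
  rw [gradient_gradInv h]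
  simp only [Psi, G, Pi.sub_apply, inner_neg_left, inner_sub_right]
  rw [real_inner_comm Ξ τ, real_inner_comm (gradInv σI σE (-τ)) τ]
  ring

theorem gradient_Sigma (h : AdmissiblePotentials σI σE) (Ξ : MinorSpace d) :
    gradient (σI - σE) Ξ = gradient σI Ξ - gradient σE Ξ := by
  simp only [gradient]
  rw [fderiv_sub (h.contDiff_I.differentiable (by norm_num) Ξ)
    (h.contDiff_E.differentiable (by norm_num) Ξ), map_sub]

/-- `∇_τ Ψ(Ξ, τ) = Ξ - (∇Σ)⁻¹(-τ)`. -/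
theorem gradient_Psi (h : AdmissiblePotentials σI σE) (Ξ τ : MinorSpace d) :
    gradient (fun τ => Psi σI σE Ξ τ) τ = Ξ - gradInv σI σE (-τ) := by
  have h1 : HasFDerivAt (fun τ => Psi σI σE Ξ τ)
      (0 + innerSL ℝ Ξ + (InnerProductSpace.toDual ℝ (MinorSpace d)) (-(gradInv σI σE (-τ)))) τ :=
    ((hasFDerivAt_const _ _).add (innerSL ℝ Ξ).hasFDerivAt).add (hasGradientAt_G h τ).hasFDerivAt
  refine HasGradientAt.gradient (hasGradientAt_iff_hasFDerivAt.2 (h1.congr_fderiv ?_))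
  ext1 k
  simp [sub_eq_add_neg]

/-- The gradients of `Σ` at `Ξ` and at `(∇Σ)⁻¹(-τ)` differ by the distance `T - ∇σ_E(Ξ)` to
equilibrium. -/
theorem neg_tau_eq (h : AdmissiblePotentials σI σE) (F : Mat d) (T : MinorSpace d) :
    gradient (σI - σE) (Phi F) - gradient (σI - σE) (gradInv σI σE (-(T - gradient σI (Phi F))))
      = T - gradient σE (Phi F) := by
  rw [gradient_gradInv h, gradient_Sigma h]
  abel

theorem dissipation_eq (h : AdmissiblePotentials σI σE) (F : Mat d) (T : MinorSpace d) :
    dissipation σI σE F T = inner ℝ (Phi F - gradInv σI σE (-(T - gradient σI (Phi F))))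
      (T - gradient σE (Phi F)) := by
  rw [dissipation, gradient_Psi h, ← sum_mul_eq_inner]
  rfl

theorem relEnergy_eq (v : Space d) (F : Mat d) (T : MinorSpace d)
    (vh : Space d) (Fh : Mat d) :
    relEnergy σI σE v F T vh Fh = 1 / 2 * ‖v - vh‖ ^ 2
      + (σI (Phi F) + inner ℝ (Phi F) (T - gradient σI (Phi F)) + G σI σE (T - gradient σI (Phi F)))
      - σE (Phi Fh) - fderiv ℝ σE (Phi Fh) (Phi F - Phi Fh) := by
  rw [relEnergy, ← inner_gradient, ← sum_mul_eq_inner (gradient σE (Phi Fh))]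
  rfl

variable {γI γv : ℝ}

theorem ConvexityBounds.hess_Sigma_nonneg (hc : ConvexityBounds γI γv σI σE)
    (Ξ k : MinorSpace d) : 0 ≤ hess (σI - σE) Ξ k k := by
  rcases eq_or_ne k 0 with rfl | hk
  · simp [hess]
  · exact (hc.pos Ξ k hk).le

/-- Coercivity of the dissipation. -/
theorem dissipation_ge (h : AdmissiblePotentials σI σE) (hc : ConvexityBounds γI γv σI σE)
    (hγv : 0 < γv) (F : Mat d) (T : MinorSpace d) :
    1 / γv * ‖T - gradient σE (Phi F)‖ ^ 2 ≤ dissipation σI σE F T := by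
  have h1 := norm_gradient_sub_sq_le_inner (contDiff_Sigma h) hγv hc.hess_Sigma_nonneg hc.upper
    (Phi F) (gradInv σI σE (-(T - gradient σI (Phi F))))
  rwa [neg_tau_eq h, ← dissipation_eq h] at h1

theorem Psi_sub_ge (h : AdmissiblePotentials σI σE) (hc : ConvexityBounds γI γv σI σE)
    (hγv : 0 < γv) (F : Mat d) (T : MinorSpace d) :
    1 / (2 * γv) * ‖T - gradient σE (Phi F)‖ ^ 2
      ≤ Psi σI σE (Phi F) (T - gradient σI (Phi F)) - σE (Phi F) := by
  have h1 := norm_gradient_sub_sq_le_bregman (contDiff_Sigma h) hγv hc.hess_Sigma_nonneg hc.upper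
    (Phi F) (gradInv σI σE (-(T - gradient σI (Phi F))))
  rwa [neg_tau_eq h, ← Psi_sub_eq_bregman h] at h1

theorem Psi_sub_le_dissipation (h : AdmissiblePotentials σI σE)
    (F : Mat d) (T : MinorSpace d) :
    Psi σI σE (Phi F) (T - gradient σI (Phi F)) - σE (Phi F) ≤ dissipation σI σE F T := by
  have h1 := Sigma_lower h (Phi F) (gradInv σI σE (-(T - gradient σI (Phi F))))
  rw [Psi_sub_eq_bregman h, dissipation_eq h, ← neg_tau_eq h,
    real_inner_comm (_ - _) (Phi F - _), inner_sub_left]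
  rw [← neg_sub (Phi F), inner_neg_right] at h1
  linarith

theorem ConvexityBounds.hess_E_ge (h : AdmissiblePotentials σI σE)
    (hc : ConvexityBounds γI γv σI σE) (Ξ k : MinorSpace d) :
    (γI - γv) * ‖k‖ ^ 2 ≤ hess σE Ξ k k := by
  have h1 := hc.upper Ξ k
  rw [hess_sub h.contDiff_I (h.contDiff_E.of_le (by norm_num))] at h1
  linarith [hc.lower_I Ξ k]

/-- The relative energy controls the distance of the states. -/
theorem relEnergy_ge (h : AdmissiblePotentials σI σE) (hc : ConvexityBounds γI γv σI σE)
    (hγv : 0 < γv) (v : Space d) (F : Mat d) (T : MinorSpace d) (vh : Space d) (Fh : Mat d) :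
    1 / 2 * ‖v - vh‖ ^ 2 + (γI - γv) / 2 * ‖Phi F - Phi Fh‖ ^ 2
      + 1 / (2 * γv) * ‖T - gradient σE (Phi F)‖ ^ 2 ≤ relEnergy σI σE v F T vh Fh := by
  have h1 := Psi_sub_ge h hc hγv F T
  have h2 := taylor_lower (h.contDiff_E.of_le (by norm_num)) (hc.hess_E_ge h) (Phi Fh) (Phi F)
  rw [relEnergy_eq]
  rw [Psi] at h1
  linarith

theorem relEnergy_le (h : AdmissiblePotentials σI σE) {M : ℝ} (hM : DerivativeBounds M σE)
    (v : Space d) (F : Mat d) (T : MinorSpace d) (vh : Space d) (Fh : Mat d) :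
    relEnergy σI σE v F T vh Fh ≤ 1 / 2 * ‖v - vh‖ ^ 2 + dissipation σI σE F T
      + M / 2 * ‖Phi F - Phi Fh‖ ^ 2 := by
  have h1 := Psi_sub_le_dissipation h F T
  have h2 := taylor_upper (h.contDiff_E.of_le (by norm_num)) (m := M)
    (fun Ξ k => (le_abs_self _).trans ((abs_hess_le hM Ξ k k).trans_eq (by ring)))
    (Phi Fh) (Phi F)
  rw [relEnergy_eq]
  rw [Psi] at h1
  linarith

end Gap

/-! ### The relative energy identity -/

section Slices

variable {d : ℕ} {tf : ℝ} {E : Type*} [NormedAddCommGroup E] [NormedSpace ℝ E]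
  {u : ℝ → Space d → E}

theorem contDiff_slice_space
    (hu : ContDiffOn ℝ 1 (fun p : ℝ × Space d => u p.1 p.2) (Icc 0 tf ×ˢ univ))
    {t : ℝ} (ht : t ∈ Icc 0 tf) : ContDiff ℝ 1 (u t) := by
  rw [← contDiffOn_univ]
  exact hu.comp (f := fun z : Space d => (t, z)) (by fun_prop) fun z _ => ⟨ht, mem_univ _⟩

theorem contDiffOn_slice_time
    (hu : ContDiffOn ℝ 1 (fun p : ℝ × Space d => u p.1 p.2) (Icc 0 tf ×ˢ univ))
    (x : Space d) : ContDiffOn ℝ 1 (fun s => u s x) (Icc 0 tf) :=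
  hu.comp (f := fun s : ℝ => (s, x)) (by fun_prop) fun s hs => ⟨hs, mem_univ _⟩

theorem hasDerivWithinAt_slice_time
    (hu : ContDiffOn ℝ 1 (fun p : ℝ × Space d => u p.1 p.2) (Icc 0 tf ×ˢ univ))
    (x : Space d) {t : ℝ} (ht : t ∈ Icc 0 tf) :
    HasDerivWithinAt (fun s => u s x) (derivWithin (fun s => u s x) (Icc 0 tf) t) (Icc 0 tf) t :=
  ((contDiffOn_slice_time hu x).differentiableOn (by norm_num) t ht).hasDerivWithinAt

theorem differentiable_slice_space
    (hu : ContDiffOn ℝ 1 (fun p : ℝ × Space d => u p.1 p.2) (Icc 0 tf ×ˢ univ))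
    {t : ℝ} (ht : t ∈ Icc 0 tf) : Differentiable ℝ (u t) :=
  (contDiff_slice_space hu ht).differentiable (by norm_num)

end Slices

theorem eq_sum_single {ι : Type*} [Fintype ι] [DecidableEq ι] (w : EuclideanSpace ℝ ι) :
    w = ∑ A, w A • EuclideanSpace.single A (1 : ℝ) := by
  ext B
  simp [Pi.single_apply]

theorem hasDerivWithinAt_coord {ι : Type*} [Fintype ι] {u : ℝ → EuclideanSpace ℝ ι}
    {u' : EuclideanSpace ℝ ι} {s : Set ℝ} {t : ℝ} (h : HasDerivWithinAt u u' s t) (i : ι) :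
    HasDerivWithinAt (fun r => u r i) (u' i) s t :=
  (EuclideanSpace.proj (𝕜 := ℝ) i).hasFDerivAt.comp_hasDerivWithinAt t h

theorem differentiableAt_coord {ι E : Type*} [Fintype ι] [NormedAddCommGroup E] [NormedSpace ℝ E]
    {u : E → EuclideanSpace ℝ ι} {x : E} (h : DifferentiableAt ℝ u x) (i : ι) :
    DifferentiableAt ℝ (fun z => u z i) x :=
  (EuclideanSpace.proj (𝕜 := ℝ) i).differentiableAt.comp x h

theorem hasDerivWithinAt_Phi {d : ℕ} {u : ℝ → Mat d} {u' : Fin d → Fin d → ℝ} {s : Set ℝ} {t : ℝ}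
    (h : ∀ i α, HasDerivWithinAt (fun r => u r i α) (u' i α) s t) :
    HasDerivWithinAt (fun r => Phi (u r)) (∑ i, ∑ α, u' i α • dPhi (u t) i α) s t := by
  have h1 := (hasFDerivWithinAt_Phi fun i α => (h i α).hasFDerivWithinAt).hasDerivWithinAt
  refine h1.congr_deriv ?_
  simp

theorem hasFDerivAt_Phi {d : ℕ} {u : Space d → Mat d} {x : Space d}
    (h : ∀ i α, DifferentiableAt ℝ (fun z => u z i α) x) :
    HasFDerivAt (fun z => Phi (u z))
      (∑ i, ∑ α, (fderiv ℝ (fun z => u z i α) x).smulRight (dPhi (u x) i α)) x := by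
  rw [← hasFDerivWithinAt_univ]
  exact hasFDerivWithinAt_Phi fun i α => (h i α).hasFDerivAt.hasFDerivWithinAt

theorem differentiableAt_dPhi {d : ℕ} (hd : d = 2 ∨ d = 3) {u : Space d → Mat d} {x : Space d}
    (h : ∀ i α, DifferentiableAt ℝ (fun z => u z i α) x) (i α : Fin d) (A : MinorIdx d) :
    DifferentiableAt ℝ (fun z => dPhi (u z) i α A) x := by
  obtain ⟨a, ℓ, ha⟩ := exists_dPhi_affine hd
  simp only [ha]
  exact ((ℓ i α A).differentiableAt.comp x (hasFDerivAt_Phi h).differentiableAt).const_add _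

theorem differentiableAt_gradient_Phi {d : ℕ} {σ : MinorSpace d → ℝ} (hσ : ContDiff ℝ 2 σ)
    {u : Space d → Mat d} {x : Space d}
    (h : ∀ i α, DifferentiableAt ℝ (fun z => u z i α) x) (A : MinorIdx d) :
    DifferentiableAt ℝ (fun z => gradient σ (Phi (u z)) A) x := by
  simp only [gradient_apply]
  exact ((hasFDerivAt_fderiv_of_contDiff hσ _).differentiableAt.comp x
    (hasFDerivAt_Phi h).differentiableAt).clm_apply (differentiableAt_const _)

/-- A continuously differentiable gradient field is curl free. -/
theorem pd_comm_of_gradient {d : ℕ} {F : Space d → Mat d} {y : Space d → Space d} {x : Space d}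
    (hF : ∀ i α, DifferentiableAt ℝ (fun z => F z i α) x) (hy : Differentiable ℝ y)
    (hFy : ∀ z i α, F z i α = pd α (fun w => y w i) z) (i α β : Fin d) :
    pd β (fun z => F z i α) x = pd α (fun z => F z i β) x := by
  have h1 : ∀ z, HasFDerivAt (fun w => y w i)
      (∑ γ, F z i γ • (EuclideanSpace.proj γ : Space d →L[ℝ] ℝ)) z := by
    intro z
    refine (differentiableAt_coord (hy z) i).hasFDerivAt.congr_fderiv ?_
    refine ContinuousLinearMap.coe_injective
      ((EuclideanSpace.basisFun (Fin d) ℝ).toBasis.ext fun γ => ?_)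
    simp [hFy, pd]
  have h2 : HasFDerivAt (fun z => ∑ γ, F z i γ • (EuclideanSpace.proj γ : Space d →L[ℝ] ℝ))
      (∑ γ, (fderiv ℝ (fun z => F z i γ) x).smulRight
        (EuclideanSpace.proj γ : Space d →L[ℝ] ℝ)) x := by
    refine HasFDerivAt.fun_sum fun γ _ => ?_
    exact HasFDerivAt.smul_const (hF i γ).hasFDerivAt (EuclideanSpace.proj γ : Space d →L[ℝ] ℝ)
  have := second_derivative_symmetric h1 h2 (EuclideanSpace.single β 1) (EuclideanSpace.single α 1)
  simpa [pd, PiLp.single_apply] using this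

section Identity

variable {d : ℕ} {σI σE : MinorSpace d → ℝ}

/-- Time derivative of the relative energy in terms of the time derivatives of the fields; the
transport of `σ_E` along the second solution cancels to first order. -/
theorem hasDerivWithinAt_relEnergy (h : AdmissiblePotentials σI σE) {s : Set ℝ} {t : ℝ}
    {v vh : ℝ → Space d} {F Fh : ℝ → Mat d} {T : ℝ → MinorSpace d}
    {v' vh' : Space d} {Ξ' Ξh' τ' : MinorSpace d}
    (hv : HasDerivWithinAt v v' s t) (hvh : HasDerivWithinAt vh vh' s t)
    (hΞ : HasDerivWithinAt (fun r => Phi (F r)) Ξ' s t)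
    (hΞh : HasDerivWithinAt (fun r => Phi (Fh r)) Ξh' s t)
    (hτ : HasDerivWithinAt (fun r => T r - gradient σI (Phi (F r))) τ' s t) :
    HasDerivWithinAt (fun r => relEnergy σI σE (v r) (F r) (T r) (vh r) (Fh r))
      (inner ℝ (v t - vh t) (v' - vh') + inner ℝ (T t) Ξ' - fderiv ℝ σE (Phi (Fh t)) Ξ'
        + inner ℝ (Phi (F t) - gradInv σI σE (-(T t - gradient σI (Phi (F t))))) τ'
        - hess σE (Phi (Fh t)) Ξh' (Phi (F t) - Phi (Fh t))) s t := by
  simp only [relEnergy_eq]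
  have hE : ContDiff ℝ 2 σE := h.contDiff_E.of_le (by norm_num)
  set τ : ℝ → MinorSpace d := fun r => T r - gradient σI (Phi (F r)) with hτdef
  have h1 : HasDerivWithinAt (fun r => 1 / 2 * ‖v r - vh r‖ ^ 2)
      (1 / 2 * (2 * inner ℝ (v t - vh t) (v' - vh'))) s t :=
    ((hv.sub hvh).norm_sq).const_mul (1 / 2 : ℝ)
  have h2 : HasDerivWithinAt (fun r => σI (Phi (F r))) (fderiv ℝ σI (Phi (F t)) Ξ') s t :=
    (h.contDiff_I.differentiable (by norm_num) (Phi (F t))).hasFDerivAt.comp_hasDerivWithinAt t hΞ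
  have h3 : HasDerivWithinAt (fun r => inner ℝ (Phi (F r)) (τ r))
      (inner ℝ (Phi (F t)) τ' + inner ℝ Ξ' (τ t)) s t := hΞ.inner ℝ hτ
  have h4 : HasDerivWithinAt (fun r => G σI σE (τ r))
      (inner ℝ (-(gradInv σI σE (-(τ t)))) τ') s t :=
    (hasGradientAt_G h (τ t)).hasFDerivAt.comp_hasDerivWithinAt t hτ
  have h5 : HasDerivWithinAt (fun r => σE (Phi (Fh r))) (fderiv ℝ σE (Phi (Fh t)) Ξh') s t :=
    (hE.differentiable (by norm_num) (Phi (Fh t))).hasFDerivAt.comp_hasDerivWithinAt t hΞh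
  have h6' : HasDerivWithinAt (fun r => fderiv ℝ σE (Phi (Fh r)))
      (fderiv ℝ (fderiv ℝ σE) (Phi (Fh t)) Ξh') s t :=
    (hasFDerivAt_fderiv_of_contDiff hE (Phi (Fh t))).comp_hasDerivWithinAt t hΞh
  have h6 : HasDerivWithinAt (fun r => fderiv ℝ σE (Phi (Fh r)) (Phi (F r) - Phi (Fh r)))
      (fderiv ℝ (fderiv ℝ σE) (Phi (Fh t)) Ξh' (Phi (F t) - Phi (Fh t))
        + fderiv ℝ σE (Phi (Fh t)) (Ξ' - Ξh')) s t :=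
    h6'.clm_apply (hΞ.fun_sub hΞh)
  have h7 := ((h1.fun_add ((h2.fun_add h3).fun_add h4)).fun_sub h5).fun_sub h6
  refine h7.congr_deriv ?_
  have e1 : inner ℝ (T t) Ξ' = inner ℝ Ξ' (τ t) + fderiv ℝ σI (Phi (F t)) Ξ' := by
    rw [← inner_gradient, real_inner_comm (τ t) Ξ', ← inner_add_left]
    simp [hτdef]
  have e2 : T t - gradient σI (Phi (F t)) = τ t := rfl
  rw [e1, e2, inner_sub_left (Phi (F t)), inner_neg_left, hess, map_sub (fderiv ℝ σE (Phi (Fh t)))]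
  ring

/-- The divergence of a product of scalar fields with the derivative of the null Lagrangians does
not see the latter, by Piola's identity. -/
theorem sum_pd_mul_dPhi (hd : d = 2 ∨ d = 3) {u : Space d → Mat d} {x : Space d}
    (hu : ∀ i α, DifferentiableAt ℝ (fun z => u z i α) x)
    (hcurl : ∀ i α β, pd β (fun z => u z i α) x = pd α (fun z => u z i β) x)
    {S : MinorIdx d → Space d → ℝ} (hS : ∀ A, DifferentiableAt ℝ (S A) x) (i : Fin d) :
    ∑ α, pd α (fun z => ∑ A, S A z * dPhi (u z) i α A) x
      = ∑ α, ∑ A, pd α (S A) x * dPhi (u x) i α A := by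
  have h1 : ∀ α, pd α (fun z => ∑ A, S A z * dPhi (u z) i α A) x
      = ∑ A, (pd α (S A) x * dPhi (u x) i α A + S A x * pd α (fun z => dPhi (u z) i α A) x) := by
    intro α
    rw [pd_sum _ fun A _ => (hS A).fun_mul (differentiableAt_dPhi hd hu i α A)]
    exact Finset.sum_congr rfl fun A _ => pd_mul (hS A) (differentiableAt_dPhi hd hu i α A)
  simp only [h1, Finset.sum_add_distrib]
  rw [Finset.sum_comm (f := fun α A => S A x * pd α (fun z => dPhi (u z) i α A) x)]
  simp only [← Finset.mul_sum, sum_pd_dPhi_eq_zero hd hu hcurl, mul_zero, Finset.sum_const_zero,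
    add_zero]

theorem IsRelaxationSolution.curl_free {ε tf : ℝ} {v : ℝ → Space d → Space d}
    {F : ℝ → Space d → Mat d} {T : ℝ → Space d → MinorSpace d}
    (hS : IsRelaxationSolution σI σE ε tf v F T) {t : ℝ} (ht : t ∈ Icc 0 tf) (x : Space d)
    (i α β : Fin d) : pd β (fun z => F t z i α) x = pd α (fun z => F t z i β) x :=
  sub_eq_zero.1 (hS.curlFree t ht x i α β)

theorem IsElasticSolution.curl_free {tf : ℝ} {v : ℝ → Space d → Space d}
    {F : ℝ → Space d → Mat d} (hS : IsElasticSolution σE tf v F) {t : ℝ} (ht : t ∈ Icc 0 tf)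
    (x : Space d) (i α β : Fin d) :
    pd β (fun z => F t z i α) x = pd α (fun z => F t z i β) x := by
  obtain ⟨y, hy⟩ := hS.isGradient
  exact pd_comm_of_gradient
    (fun i α => differentiable_slice_space (u := fun t x => F t x i α) (hS.contDiff_F i α) ht x)
    (hy t ht).1 (hy t ht).2 i α β

/-- The relative energy identity, together with the differentiability of its ingredients. -/
theorem relEnergy_identity (hd : d = 2 ∨ d = 3) {tf : ℝ} (htf : 0 < tf)
    (h : AdmissiblePotentials σI σE) {vh : ℝ → Space d → Space d} {Fh : ℝ → Space d → Mat d}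
    (hE : IsElasticSolution σE tf vh Fh) {ε : ℝ} {v : ℝ → Space d → Space d}
    {F : ℝ → Space d → Mat d} {T : ℝ → Space d → MinorSpace d}
    (hS : IsRelaxationSolution σI σE ε tf v F T) {t : ℝ} (ht : t ∈ Icc 0 tf) (x : Space d) :
    (∀ α, DifferentiableAt ℝ
        (fun z => relFlux σE (v t z) (F t z) (T t z) (vh t z) (Fh t z) α) x) ∧
    DifferentiableWithinAt ℝ
        (fun s => relEnergy σI σE (v s x) (F s x) (T s x) (vh s x) (Fh s x)) (Icc 0 tf) t ∧
    derivWithin (fun s => relEnergy σI σE (v s x) (F s x) (T s x) (vh s x) (Fh s x)) (Icc 0 tf) t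
        - ∑ α, pd α (fun z => relFlux σE (v t z) (F t z) (T t z) (vh t z) (Fh t z) α) x
        + 1 / ε * dissipation σI σE (F t x) (T t x)
      = Q1 σE (v t) (F t) (vh t) (Fh t) x + Q2 σE (F t) (vh t) (Fh t) x
        + Q3 σE (F t) (vh t) (Fh t) x + linErr σE (F t) (T t) (vh t) x := by
  have hE2 : ContDiff ℝ 2 σE := h.contDiff_E.of_le (by norm_num)
  have hu : UniqueDiffWithinAt ℝ (Icc 0 tf) t := uniqueDiffOn_Icc htf t ht
  have hvx : ∀ i, DifferentiableAt ℝ (fun z => v t z i) x :=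
    fun i => differentiableAt_coord (differentiable_slice_space hS.contDiff_v ht x) i
  have hvhx : ∀ i, DifferentiableAt ℝ (fun z => vh t z i) x :=
    fun i => differentiableAt_coord (differentiable_slice_space hE.contDiff_v ht x) i
  have hTx : ∀ A, DifferentiableAt ℝ (fun z => T t z A) x :=
    fun A => differentiableAt_coord (differentiable_slice_space hS.contDiff_T ht x) A
  have hFx : ∀ i α, DifferentiableAt ℝ (fun z => F t z i α) x := fun i α =>
    differentiable_slice_space (u := fun t x => F t x i α) (hS.contDiff_F i α) ht x
  have hFhx : ∀ i α, DifferentiableAt ℝ (fun z => Fh t z i α) x := fun i α =>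
    differentiable_slice_space (u := fun t x => Fh t x i α) (hE.contDiff_F i α) ht x
  have hgx : ∀ A, DifferentiableAt ℝ (fun z => gradient σE (Phi (Fh t z)) A) x :=
    fun A => differentiableAt_gradient_Phi hE2 hFhx A
  -- the flux
  have hprod : ∀ i A, DifferentiableAt ℝ
      (fun z => (T t z A - gradient σE (Phi (Fh t z)) A) * (v t z i - vh t z i)) x :=
    fun i A => ((hTx A).fun_sub (hgx A)).fun_mul ((hvx i).fun_sub (hvhx i))
  have hterm : ∀ α i, DifferentiableAt ℝ (fun z => ∑ A, (T t z A - gradient σE (Phi (Fh t z)) A)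
      * (v t z i - vh t z i) * dPhi (F t z) i α A) x :=
    fun α i => DifferentiableAt.fun_sum fun A _ =>
      (hprod i A).fun_mul (differentiableAt_dPhi hd hFx i α A)
  have hflux : ∀ α, DifferentiableAt ℝ
      (fun z => relFlux σE (v t z) (F t z) (T t z) (vh t z) (Fh t z) α) x :=
    fun α => DifferentiableAt.fun_sum fun i _ => hterm α i
  have hdiv : ∑ α, pd α (fun z => relFlux σE (v t z) (F t z) (T t z) (vh t z) (Fh t z) α) x
      = ∑ α, ∑ i, ∑ A,
        ((pd α (fun z => T t z A) x - pd α (fun z => gradient σE (Phi (Fh t z)) A) x)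
            * (v t x i - vh t x i)
          + (T t x A - gradient σE (Phi (Fh t x)) A)
            * (pd α (fun z => v t z i) x - pd α (fun z => vh t z i) x)) * dPhi (F t x) i α A := by
    have e1 : ∀ α, pd α (fun z => relFlux σE (v t z) (F t z) (T t z) (vh t z) (Fh t z) α) x
        = ∑ i, pd α (fun z => ∑ A, (T t z A - gradient σE (Phi (Fh t z)) A)
            * (v t z i - vh t z i) * dPhi (F t z) i α A) x :=
      fun α => pd_sum _ fun i _ => hterm α i
    simp only [e1]
    rw [Finset.sum_comm, Finset.sum_comm (γ := Fin d) (s := Finset.univ) (t := Finset.univ)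
      (f := fun α i => ∑ A, _)]
    refine Finset.sum_congr rfl fun i _ => ?_
    rw [sum_pd_mul_dPhi hd hFx (hS.curl_free ht x) (hprod i)]
    refine Finset.sum_congr rfl fun α _ => Finset.sum_congr rfl fun A _ => ?_
    rw [pd_mul ((hTx A).fun_sub (hgx A)) ((hvx i).fun_sub (hvhx i)), pd_sub (hTx A) (hgx A),
      pd_sub (hvx i) (hvhx i)]
  -- the time derivatives
  have hv := hasDerivWithinAt_slice_time hS.contDiff_v x ht
  have hvh := hasDerivWithinAt_slice_time hE.contDiff_v x ht
  have hF : ∀ i α, HasDerivWithinAt (fun s => F s x i α) (pd α (fun z => v t z i) x)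
      (Icc 0 tf) t := fun i α => by
    rw [← sub_eq_zero.1 (hS.kinematic t ht x i α)]
    exact hasDerivWithinAt_slice_time (u := fun t x => F t x i α) (hS.contDiff_F i α) x ht
  have hFh : ∀ i α, HasDerivWithinAt (fun s => Fh s x i α) (pd α (fun z => vh t z i) x)
      (Icc 0 tf) t := fun i α => by
    rw [← sub_eq_zero.1 (hE.kinematic t ht x i α)]
    exact hasDerivWithinAt_slice_time (u := fun t x => Fh t x i α) (hE.contDiff_F i α) x ht
  have hΞ := hasDerivWithinAt_Phi hF
  have hΞh := hasDerivWithinAt_Phi hFh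
  have hτ : HasDerivWithinAt (fun s => T s x - gradient σI (Phi (F s x)))
      (-(1 / ε) • (T t x - gradient σE (Phi (F t x)))) (Icc 0 tf) t := by
    have hg : DifferentiableWithinAt ℝ (fun s => gradient σI (Phi (F s x))) (Icc 0 tf) t :=
      (InnerProductSpace.toDual ℝ (MinorSpace d)).symm.differentiable _
        |>.comp_differentiableWithinAt t
          ((hasFDerivAt_fderiv_of_contDiff h.contDiff_I _).differentiableAt
          |>.comp_differentiableWithinAt t hΞ.differentiableWithinAt)
    have h1 := ((hasDerivWithinAt_slice_time hS.contDiff_T x ht).differentiableWithinAt.fun_sub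
      hg).hasDerivWithinAt
    refine h1.congr_deriv ?_
    ext A
    rw [← (hasDerivWithinAt_coord h1 A).derivWithin hu]
    exact hS.relaxation t ht x A
  have hder := hasDerivWithinAt_relEnergy h hv hvh hΞ hΞh hτ
  refine ⟨hflux, hder.differentiableWithinAt, ?_⟩
  rw [hder.derivWithin hu, hdiv, dissipation_eq h, inner_smul_right]
  have hvi : ∀ i, derivWithin (fun s => v s x) (Icc 0 tf) t i
      = ∑ α, ∑ A, pd α (fun z => T t z A) x * dPhi (F t x) i α A := fun i => by
    rw [← (hasDerivWithinAt_coord hv i).derivWithin hu, sub_eq_zero.1 (hS.momentum t ht x i),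
      sum_pd_mul_dPhi hd hFx (hS.curl_free ht x) hTx]
  have hvhi : ∀ i, derivWithin (fun s => vh s x) (Icc 0 tf) t i
      = ∑ α, ∑ A, pd α (fun z => gradient σE (Phi (Fh t z)) A) x * dPhi (Fh t x) i α A :=
    fun i => by
    rw [← (hasDerivWithinAt_coord hvh i).derivWithin hu, sub_eq_zero.1 (hE.momentum t ht x i),
      sum_pd_mul_dPhi hd hFhx (hE.curl_free ht x) hgx]
  have k1 : inner ℝ (v t x - vh t x) (derivWithin (fun s => v s x) (Icc 0 tf) t
        - derivWithin (fun s => vh s x) (Icc 0 tf) t)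
      = ∑ α, ∑ i, ∑ A, (v t x i - vh t x i) * (pd α (fun z => T t z A) x * dPhi (F t x) i α A
        - pd α (fun z => gradient σE (Phi (Fh t z)) A) x * dPhi (Fh t x) i α A) := by
    rw [← sum_mul_eq_inner, Finset.sum_comm]
    refine Finset.sum_congr rfl fun i _ => ?_
    simp only [PiLp.sub_apply, hvi, hvhi, ← Finset.sum_sub_distrib, Finset.mul_sum]
  have k2 : ∀ w : MinorSpace d, inner ℝ w (∑ i, ∑ α, pd α (fun z => v t z i) x • dPhi (F t x) i α)
      = ∑ α, ∑ i, ∑ A, w A * (pd α (fun z => v t z i) x * dPhi (F t x) i α A) := by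
    intro w
    rw [Finset.sum_comm]
    simp only [inner_sum, ← sum_mul_eq_inner, PiLp.smul_apply, smul_eq_mul]
  have k3 : hess σE (Phi (Fh t x)) (∑ i, ∑ α, pd α (fun z => vh t z i) x • dPhi (Fh t x) i α)
        (Phi (F t x) - Phi (Fh t x))
      = ∑ α, ∑ i, ∑ A, pd α (fun z => vh t z i) x * dPhi (Fh t x) i α A
        * hess σE (Phi (Fh t x)) (EuclideanSpace.single A 1) (Phi (F t x) - Phi (Fh t x)) := by
    rw [Finset.sum_comm]
    simp only [hess, map_sum, map_smul, sum_apply, smul_apply, smul_eq_mul]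
    refine Finset.sum_congr rfl fun α _ => Finset.sum_congr rfl fun i _ => ?_
    conv_lhs => rw [eq_sum_single (dPhi (Fh t x) i α)]
    simp only [map_sum, map_smul, sum_apply, smul_apply, smul_eq_mul, Finset.mul_sum, mul_assoc]
  rw [k1, k3, ← inner_gradient σE, k2, k2]
  simp only [Q1, Q2, Q3, linErr]
  have alg : ∀ a b c p e f : ℝ,
      a + b - c + -(1 / ε) * p - e - f + 1 / ε * p = a + b - c - e - f := by
    intros
    ring
  rw [alg]
  simp only [← Finset.sum_add_distrib, ← Finset.sum_sub_distrib]
  refine Finset.sum_congr rfl fun α _ => Finset.sum_congr rfl fun i _ =>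
    Finset.sum_congr rfl fun A _ => ?_
  ring

end Identity

/-! ### Pointwise bounds of the error terms -/

theorem norm_fun_le_of_entries {d : ℕ} {F : Fin d → Fin d → ℝ} {K : ℝ} (hK : 0 ≤ K)
    (h : ∀ i α, |F i α| ≤ K) : ‖F‖ ≤ K :=
  (pi_norm_le_iff_of_nonneg hK).2 fun i => (pi_norm_le_iff_of_nonneg hK).2 fun α => h i α

/-- Bounds of the null Lagrangians and of their derivatives on bounded sets of matrices. -/
theorem exists_Phi_bound (d : ℕ) {K : ℝ} (hK : 0 ≤ K) :
    ∃ P : ℝ, 0 ≤ P ∧ ∀ F : Mat d, (∀ i α, |F i α| ≤ K) →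
      ‖Phi F‖ ≤ P ∧ ∀ i α, ‖dPhi F i α‖ ≤ P := by
  have hc : IsCompact (Metric.closedBall (0 : Fin d → Fin d → ℝ) K) := isCompact_closedBall _ _
  obtain ⟨P1, hP1⟩ := hc.exists_bound_of_continuousOn (contDiff_Phi d).continuous.continuousOn
  have h2 : Continuous (fun M : Fin d → Fin d → ℝ =>
      (fun i α => dPhi (Matrix.of M) i α : Fin d → Fin d → MinorSpace d)) := by
    refine continuous_pi fun i => continuous_pi fun α => ?_
    simp only [dPhi_eq_fderiv]
    exact ((contDiff_Phi d).continuous_fderiv (by norm_num)).clm_apply continuous_const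
  obtain ⟨P2, hP2⟩ := hc.exists_bound_of_continuousOn h2.continuousOn
  refine ⟨max P1 P2 ⊔ 0, le_sup_right, fun F hF => ?_⟩
  have hm : (fun i α => F i α) ∈ Metric.closedBall (0 : Fin d → Fin d → ℝ) K :=
    mem_closedBall_zero_iff.2 (norm_fun_le_of_entries hK hF)
  refine ⟨(hP1 _ hm).trans ((le_max_left _ _).trans le_sup_left), fun i α => ?_⟩
  exact ((norm_le_pi_norm _ α).trans (norm_le_pi_norm _ i)).trans
    ((hP2 _ hm).trans ((le_max_right _ _).trans le_sup_left))

/-- Lipschitz continuity of the null Lagrangians on bounded sets of matrices. -/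
theorem exists_Phi_lipschitz (d : ℕ) {K : ℝ} (hK : 0 ≤ K) :
    ∃ L : ℝ, 0 ≤ L ∧ ∀ F F' : Mat d, (∀ i α, |F i α| ≤ K) → (∀ i α, |F' i α| ≤ K) →
      ∀ r : ℝ, 0 ≤ r → (∀ i α, |F i α - F' i α| ≤ r) → ‖Phi F - Phi F'‖ ≤ L * r := by
  obtain ⟨L, hL⟩ := (contDiff_Phi d).locallyLipschitz.locallyLipschitzOn
    |>.exists_lipschitzOnWith_of_compact (isCompact_closedBall (0 : Fin d → Fin d → ℝ) K)
  refine ⟨L, L.2, fun F F' hF hF' r hr h => ?_⟩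
  have h1 := hL.dist_le_mul (fun i α => F i α)
    (mem_closedBall_zero_iff.2 (norm_fun_le_of_entries hK hF)) (fun i α => F' i α)
    (mem_closedBall_zero_iff.2 (norm_fun_le_of_entries hK hF'))
  rw [dist_eq_norm, dist_eq_norm] at h1
  refine h1.trans (mul_le_mul_of_nonneg_left ?_ L.2)
  exact norm_fun_le_of_entries hr h

theorem exists_dPhi_lipschitz {d : ℕ} (hd : d = 2 ∨ d = 3) :
    ∃ B : ℝ, 0 ≤ B ∧ ∀ (F F' : Mat d) (i α : Fin d) (A : MinorIdx d),
      |dPhi F i α A - dPhi F' i α A| ≤ B * ‖Phi F - Phi F'‖ := by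
  obtain ⟨a, ℓ, h⟩ := exists_dPhi_affine hd
  refine ⟨∑ i, ∑ α, ∑ A, ‖ℓ i α A‖, by positivity, fun F F' i α A => ?_⟩
  rw [h, h, add_sub_add_left_eq_sub, ← map_sub]
  refine ((ℓ i α A).le_opNorm _).trans (mul_le_mul_of_nonneg_right ?_ (norm_nonneg _))
  calc ‖ℓ i α A‖ ≤ ∑ A, ‖ℓ i α A‖ :=
        Finset.single_le_sum (f := fun A => ‖ℓ i α A‖) (fun _ _ => norm_nonneg _)
          (Finset.mem_univ A)
    _ ≤ ∑ α, ∑ A, ‖ℓ i α A‖ :=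
        Finset.single_le_sum (f := fun α => ∑ A, ‖ℓ i α A‖)
          (fun _ _ => Finset.sum_nonneg fun _ _ => norm_nonneg _) (Finset.mem_univ α)
    _ ≤ ∑ i, ∑ α, ∑ A, ‖ℓ i α A‖ :=
        Finset.single_le_sum (f := fun i => ∑ α, ∑ A, ‖ℓ i α A‖)
          (fun _ _ => Finset.sum_nonneg fun _ _ => Finset.sum_nonneg fun _ _ => norm_nonneg _)
          (Finset.mem_univ i)

theorem hess_comm {d : ℕ} {σ : MinorSpace d → ℝ} (hσ : ContDiff ℝ 2 σ) (Ξ h k : MinorSpace d) :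
    hess σ Ξ h k = hess σ Ξ k h :=
  second_derivative_symmetric (f := σ) (f' := fderiv ℝ σ)
    (fun z => (hσ.differentiable (by norm_num) z).hasFDerivAt)
    (hasFDerivAt_fderiv_of_contDiff hσ Ξ) h k

theorem pd_gradient_Phi {d : ℕ} {σ : MinorSpace d → ℝ} (hσ : ContDiff ℝ 2 σ)
    {u : Space d → Mat d} {x : Space d}
    (hu : ∀ i α, DifferentiableAt ℝ (fun z => u z i α) x) (α : Fin d) (A : MinorIdx d) :
    pd α (fun z => gradient σ (Phi (u z)) A) x
      = hess σ (Phi (u x)) (∑ j, ∑ β, pd α (fun z => u z j β) x • dPhi (u x) j β)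
        (EuclideanSpace.single A 1) := by
  simp only [gradient_apply, pd]
  have h1 : HasFDerivAt (fun z => fderiv ℝ σ (Phi (u z))) _ x :=
    (hasFDerivAt_fderiv_of_contDiff hσ (Phi (u x))).comp x (hasFDerivAt_Phi hu)
  have h2 := h1.clm_apply (hasFDerivAt_const (EuclideanSpace.single A (1 : ℝ)) x)
  rw [h2.fderiv]
  simp [hess]

theorem abs_sum_three_le {ι κ μ : Type*} [Fintype ι] [Fintype κ] [Fintype μ] {f : ι → κ → μ → ℝ}
    {X : ℝ} (h : ∀ i j k, |f i j k| ≤ X) :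
    |∑ i, ∑ j, ∑ k, f i j k| ≤ (Fintype.card ι * Fintype.card κ * Fintype.card μ : ℝ) * X := by
  have h1 : ∀ i j, |∑ k, f i j k| ≤ Fintype.card μ * X := fun i j =>
    (Finset.abs_sum_le_sum_abs _ _).trans
      ((Finset.sum_le_card_nsmul _ _ _ fun k _ => h i j k).trans (by simp))
  have h2 : ∀ i, |∑ j, ∑ k, f i j k| ≤ Fintype.card κ * (Fintype.card μ * X) := fun i =>
    (Finset.abs_sum_le_sum_abs _ _).trans
      ((Finset.sum_le_card_nsmul _ _ _ fun j _ => h1 i j).trans (by simp))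
  refine ((Finset.abs_sum_le_sum_abs _ _).trans
    (Finset.sum_le_card_nsmul _ _ _ fun i _ => h2 i)).trans_eq ?_
  simp [mul_assoc]

theorem norm_sum_sum_smul_le {ι κ E : Type*} [Fintype ι] [Fintype κ] [NormedAddCommGroup E]
    [NormedSpace ℝ E] {c : ι → κ → ℝ} {w : ι → κ → E} {a b : ℝ} (ha : 0 ≤ a)
    (hc : ∀ i j, |c i j| ≤ a) (hw : ∀ i j, ‖w i j‖ ≤ b) :
    ‖∑ i, ∑ j, c i j • w i j‖ ≤ (Fintype.card ι * Fintype.card κ : ℝ) * (a * b) := by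
  have h0 : ∀ i j, ‖c i j • w i j‖ ≤ a * b := fun i j => by
    rw [norm_smul]
    exact mul_le_mul (hc i j) (hw i j) (norm_nonneg _) ha
  have h1 : ∀ i, ‖∑ j, c i j • w i j‖ ≤ Fintype.card κ * (a * b) := fun i =>
    (norm_sum_le _ _).trans ((Finset.sum_le_card_nsmul _ _ _ fun j _ => h0 i j).trans (by simp))
  refine ((norm_sum_le _ _).trans
    (Finset.sum_le_card_nsmul _ _ _ fun i _ => h1 i)).trans_eq ?_
  simp [mul_assoc]

theorem abs_coord_le {ι : Type*} [Fintype ι] (w : EuclideanSpace ℝ ι) (i : ι) : |w i| ≤ ‖w‖ :=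
  PiLp.norm_apply_le w i

/-- The quadratic errors are controlled by the relative energy, and so is the linear error up to a
term of first order in the distance `T - ∇σ_E(Φ(F))` to equilibrium, which is localized by the
gradient of `v̂`. -/
theorem exists_errors_le {d : ℕ} (hd : d = 2 ∨ d = 3) {γI γv M K : ℝ} (hγv : 0 < γv)
    (hγ : γv < γI) (hM : 0 < M) (hK : 0 ≤ K) :
    ∃ C₁ C₂ : ℝ, 0 ≤ C₁ ∧ 0 ≤ C₂ ∧
      ∀ (σI σE : MinorSpace d → ℝ), AdmissiblePotentials σI σE →
      ConvexityBounds γI γv σI σE → DerivativeBounds M σE →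
      ∀ (v : Space d → Space d) (F : Space d → Mat d) (T : Space d → MinorSpace d)
        (vh : Space d → Space d) (Fh : Space d → Mat d) (x : Space d),
      (∀ i α, DifferentiableAt ℝ (fun z => Fh z i α) x) →
      (∀ i α, |Fh x i α| ≤ K) →
      (∀ i α, |pd α (fun z => vh z i) x| ≤ K) →
      (∀ i β α, |pd α (fun z => Fh z i β) x| ≤ K) →
      |Q1 σE v F vh Fh x + Q2 σE F vh Fh x + Q3 σE F vh Fh x|
          ≤ C₁ * relEnergy σI σE (v x) (F x) (T x) (vh x) (Fh x) ∧
      ∀ κ : ℝ, (∀ i α, |pd α (fun z => vh z i) x| ≤ κ) →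
        |linErr σE F T vh x| ≤ C₁ * relEnergy σI σE (v x) (F x) (T x) (vh x) (Fh x)
          + C₂ * κ * ‖T x - gradient σE (Phi (F x))‖ := by
  obtain ⟨B, hB0, hB⟩ := exists_dPhi_lipschitz hd
  obtain ⟨P, hP0, hP⟩ := exists_Phi_bound d hK
  set N : ℝ := (Fintype.card (Fin d) * Fintype.card (Fin d) * Fintype.card (MinorIdx d) : ℝ) with hN
  have hN0 : 0 ≤ N := by positivity
  set H : ℝ := M * ((Fintype.card (Fin d) * Fintype.card (Fin d) : ℝ) * (K * P)) with hH
  have hH0 : 0 ≤ H := by positivity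
  have hδ : 0 < γI - γv := sub_pos.2 hγ
  set Λ : ℝ := 2 + 2 / (γI - γv) + 2 * γv with hΛ
  have hΛ0 : 0 ≤ Λ := by positivity
  refine ⟨N * (H * B + K * P * M + K * M * B + K * B) * Λ, N * P, by positivity, by positivity, ?_⟩
  intro σI σE h hc hMb v F T vh Fh x hFhd hFh hvh hDFh
  set e := relEnergy σI σE (v x) (F x) (T x) (vh x) (Fh x) with he
  set n := ‖Phi (F x) - Phi (Fh x)‖ with hn
  set m := ‖v x - vh x‖ with hm
  set r := ‖T x - gradient σE (Phi (F x))‖ with hr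
  have hn0 : 0 ≤ n := norm_nonneg _
  have hm0 : 0 ≤ m := norm_nonneg _
  have hr0 : 0 ≤ r := norm_nonneg _
  have hE2 : ContDiff ℝ 2 σE := h.contDiff_E.of_le (by norm_num)
  have hge := relEnergy_ge h hc hγv (v x) (F x) (T x) (vh x) (Fh x)
  rw [← he, ← hn, ← hm, ← hr] at hge
  have p1 : 0 ≤ (γI - γv) / 2 * n ^ 2 := by positivity
  have p2 : 0 ≤ 1 / (2 * γv) * r ^ 2 := by positivity
  have p3 : 0 ≤ 1 / 2 * m ^ 2 := by positivity
  have he0 : 0 ≤ e := by linarith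
  have hm2 : m ^ 2 ≤ 2 * e := by linarith
  have hn2 : n ^ 2 ≤ 2 / (γI - γv) * e := by
    rw [div_mul_eq_mul_div, le_div_iff₀ hδ]
    linarith
  have hr2 : r ^ 2 ≤ 2 * γv * e := by
    have : 1 / (2 * γv) * r ^ 2 ≤ e := by linarith
    rwa [one_div, inv_mul_le_iff₀ (by positivity)] at this
  have hΛe : Λ * e = 2 * e + 2 / (γI - γv) * e + 2 * γv * e := by rw [hΛ]; ring
  have q1 : 0 ≤ 2 / (γI - γv) * e := by positivity
  have q2 : 0 ≤ 2 * γv * e := by positivity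
  have hnn : n ^ 2 ≤ Λ * e := by linarith
  have hnm : n * m ≤ Λ * e := by linarith [two_mul_le_add_sq n m]
  have hrn : r * n ≤ Λ * e := by linarith [two_mul_le_add_sq r n]
  have hgrad : ∀ α A, |pd α (fun z => gradient σE (Phi (Fh z)) A) x| ≤ H := by
    intro α A
    rw [pd_gradient_Phi hE2 hFhd]
    refine (abs_hess_le hMb _ _ _).trans ?_
    rw [PiLp.norm_single, norm_one, mul_one]
    exact mul_le_mul_of_nonneg_left (norm_sum_sum_smul_le hK (fun j β => hDFh j β α)
      ((hP _ hFh).2)) hM.le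
  have hP' : ∀ i α A, |dPhi (Fh x) i α A| ≤ P := fun i α A =>
    (abs_coord_le _ A).trans ((hP _ hFh).2 i α)
  have hgd : ∀ A, |gradient σE (Phi (F x)) A - gradient σE (Phi (Fh x)) A| ≤ M * n := fun A =>
    (abs_coord_le (gradient σE (Phi (F x)) - gradient σE (Phi (Fh x))) A).trans
      (norm_gradient_sub_le_of_bounds h.contDiff_E hMb _ _)
  have hQ1 : |Q1 σE v F vh Fh x| ≤ N * (H * B * (n * m)) := by
    refine abs_sum_three_le fun α i A => ?_
    rw [abs_mul, abs_mul]
    calc _ ≤ H * (B * n) * m := by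
          gcongr
          · exact hgrad α A
          · exact hB _ _ _ _ _
          · exact abs_coord_le (v x - vh x) i
      _ = _ := by ring
  have hQ2 : |Q2 σE F vh Fh x| ≤ N * (K * P * M * n ^ 2) := by
    refine abs_sum_three_le fun α i A => ?_
    rw [abs_mul, abs_mul]
    have e1 : gradient σE (Phi (F x)) A - gradient σE (Phi (Fh x)) A
        - hess σE (Phi (Fh x)) (EuclideanSpace.single A 1) (Phi (F x) - Phi (Fh x))
        = (fderiv ℝ σE (Phi (F x)) - fderiv ℝ σE (Phi (Fh x))
          - fderiv ℝ (fderiv ℝ σE) (Phi (Fh x)) (Phi (F x) - Phi (Fh x)))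
          (EuclideanSpace.single A 1) := by
      rw [hess_comm hE2, gradient_apply, gradient_apply]
      rfl
    calc _ ≤ K * P * (M * n ^ 2) := by
          gcongr
          · exact hvh i α
          · exact hP' i α A
          · rw [e1]
            refine ((fderiv ℝ σE (Phi (F x)) - fderiv ℝ σE (Phi (Fh x))
              - fderiv ℝ (fderiv ℝ σE) (Phi (Fh x)) (Phi (F x) - Phi (Fh x))).le_opNorm
              (EuclideanSpace.single A 1)).trans ?_
            rw [PiLp.norm_single, norm_one, mul_one]
            exact norm_taylor_gradient_le h.contDiff_E hMb _ _
      _ = _ := by ring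
  have hQ3 : |Q3 σE F vh Fh x| ≤ N * (K * M * B * n ^ 2) := by
    refine abs_sum_three_le fun α i A => ?_
    rw [abs_mul, abs_mul]
    calc _ ≤ K * (M * n) * (B * n) := by
          gcongr
          · exact hvh i α
          · exact hgd A
          · exact hB _ _ _ _ _
      _ = _ := by ring
  have b1 : N * (H * B * (n * m)) ≤ N * (H * B * (Λ * e)) := by gcongr
  have b2 : N * (K * P * M * n ^ 2) ≤ N * (K * P * M * (Λ * e)) := by gcongr
  have b3 : N * (K * M * B * n ^ 2) ≤ N * (K * M * B * (Λ * e)) := by gcongr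
  have b4 : N * (K * B * (r * n)) ≤ N * (K * B * (Λ * e)) := by gcongr
  have c1 : 0 ≤ N * (H * B * (Λ * e)) := by positivity
  have c2 : 0 ≤ N * (K * P * M * (Λ * e)) := by positivity
  have c3 : 0 ≤ N * (K * M * B * (Λ * e)) := by positivity
  have c4 : 0 ≤ N * (K * B * (Λ * e)) := by positivity
  have hC : N * (H * B + K * P * M + K * M * B + K * B) * Λ * e
      = N * (H * B * (Λ * e)) + N * (K * P * M * (Λ * e)) + N * (K * M * B * (Λ * e))
        + N * (K * B * (Λ * e)) := by ring
  rw [hC]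
  refine ⟨?_, fun κ hκ => ?_⟩
  · refine (abs_add_three _ _ _).trans ?_
    linarith
  · have hL : |linErr σE F T vh x| ≤ N * (κ * r * P + K * B * (r * n)) := by
      refine abs_sum_three_le fun α i A => ?_
      rw [abs_mul, abs_mul]
      have hTA : |T x A - gradient σE (Phi (F x)) A| ≤ r :=
        abs_coord_le (T x - gradient σE (Phi (F x))) A
      have hκ0 : 0 ≤ κ := (abs_nonneg _).trans (hκ i α)
      have hdP : |dPhi (F x) i α A| ≤ P + B * n := by
        have e2 : dPhi (F x) i α A
          = dPhi (Fh x) i α A + (dPhi (F x) i α A - dPhi (Fh x) i α A) := by ring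
        rw [e2]
        exact (abs_add_le _ _).trans (add_le_add (hP' i α A) (hB _ _ _ _ _))
      calc _ ≤ |pd α (fun z => vh z i) x| * r * (P + B * n) := by gcongr
        _ = |pd α (fun z => vh z i) x| * (r * P) + |pd α (fun z => vh z i) x| * (B * (r * n)) := by
          ring
        _ ≤ κ * (r * P) + K * (B * (r * n)) := by
          gcongr
          · exact hκ i α
          · exact hvh i α
        _ = _ := by ring
    have : N * (κ * r * P + K * B * (r * n)) = N * P * κ * r + N * (K * B * (r * n)) := by ring
    linarith

/-! ### Decaying fields and Gronwall's inequality -/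

/-- The time-dependent field `u` is bounded by a constant multiple of the weight `w`, uniformly for
`t ∈ [0, tf]`. -/
def DomBy {d : ℕ} {E : Type*} [NormedAddCommGroup E] (tf : ℝ) (w : Space d → ℝ)
    (u : ℝ → Space d → E) : Prop :=
  ∃ K : ℝ, 0 ≤ K ∧ ∀ t ∈ Icc 0 tf, ∀ x, ‖u t x‖ ≤ K * w x

/-- An integrable weight on `ℝ^d`, at most one. -/
noncomputable def weight (d : ℕ) (x : Space d) : ℝ := ((1 + ‖x‖) ^ (d + 1))⁻¹

theorem weight_pos {d : ℕ} (x : Space d) : 0 < weight d x := by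
  unfold weight
  positivity

theorem weight_le_one {d : ℕ} (x : Space d) : weight d x ≤ 1 :=
  inv_le_one_of_one_le₀ (one_le_pow₀ (by linarith [norm_nonneg x]))

theorem integrable_weight (d : ℕ) : Integrable (weight d) := by
  have h := integrable_one_add_norm (E := Space d) (μ := volume) (r := (d + 1 : ℕ))
    (by simp)
  refine h.congr (Eventually.of_forall fun x => ?_)
  simp only [weight]
  rw [Real.rpow_neg (by positivity), Real.rpow_natCast]

section DomBy

variable {d : ℕ} {tf : ℝ} {w : Space d → ℝ} {E E' : Type*}
  [NormedAddCommGroup E] [NormedAddCommGroup E']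

theorem DomBy.of_le {u : ℝ → Space d → E} {u' : ℝ → Space d → E'} (h : DomBy tf w u)
    (hle : ∀ t ∈ Icc 0 tf, ∀ x, ‖u' t x‖ ≤ ‖u t x‖) : DomBy tf w u' := by
  obtain ⟨K, hK, h⟩ := h
  exact ⟨K, hK, fun t ht x => (hle t ht x).trans (h t ht x)⟩

theorem DomBy.of_le_mul {u : ℝ → Space d → E} {u' : ℝ → Space d → E'} (h : DomBy tf w u) {L : ℝ}
    (hL : 0 ≤ L) (hle : ∀ t ∈ Icc 0 tf, ∀ x, ‖u' t x‖ ≤ L * ‖u t x‖) : DomBy tf w u' := by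
  obtain ⟨K, hK, h⟩ := h
  refine ⟨L * K, mul_nonneg hL hK, fun t ht x => (hle t ht x).trans ?_⟩
  rw [mul_assoc]
  exact mul_le_mul_of_nonneg_left (h t ht x) hL

theorem DomBy.norm {u : ℝ → Space d → E} (h : DomBy tf w u) :
    DomBy tf w (fun t x => ‖u t x‖) :=
  h.of_le fun _ _ _ => by simp

theorem DomBy.add {u u' : ℝ → Space d → E} (h : DomBy tf w u) (h' : DomBy tf w u') :
    DomBy tf w (fun t x => u t x + u' t x) := by
  obtain ⟨K, hK, h⟩ := h
  obtain ⟨K', hK', h'⟩ := h'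
  refine ⟨K + K', by positivity, fun t ht x => (norm_add_le _ _).trans ?_⟩
  rw [add_mul]
  exact add_le_add (h t ht x) (h' t ht x)

theorem DomBy.sub {u u' : ℝ → Space d → E} (h : DomBy tf w u) (h' : DomBy tf w u') :
    DomBy tf w (fun t x => u t x - u' t x) := by
  simp only [sub_eq_add_neg]
  exact h.add (h'.of_le fun t _ x => (norm_neg _).le)

theorem DomBy.sum {ι : Type*} [Fintype ι] {u : ι → ℝ → Space d → E}
    (h : ∀ i, DomBy tf w (u i)) : DomBy tf w (fun t x => ∑ i, u i t x) := by
  choose K hK h using h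
  refine ⟨∑ i, K i, Finset.sum_nonneg fun i _ => hK i, fun t ht x => (norm_sum_le _ _).trans ?_⟩
  rw [Finset.sum_mul]
  exact Finset.sum_le_sum fun i _ => h i t ht x

/-- The product of a dominated and of a bounded field, for any product that is submultiplicative. -/
theorem DomBy.of_le_norm_mul {E'' : Type*} [NormedAddCommGroup E''] {u : ℝ → Space d → E}
    {u' : ℝ → Space d → E'} {p : ℝ → Space d → E''} (h : DomBy tf w u)
    (h' : DomBy tf (fun _ => 1) u') (hp : ∀ t ∈ Icc 0 tf, ∀ x, ‖p t x‖ ≤ ‖u t x‖ * ‖u' t x‖) :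
    DomBy tf w p := by
  obtain ⟨K, hK, h⟩ := h
  obtain ⟨K', hK', h'⟩ := h'
  refine ⟨K * K', by positivity, fun t ht x => (hp t ht x).trans ?_⟩
  calc ‖u t x‖ * ‖u' t x‖ ≤ (K * w x) * (K' * 1) :=
        mul_le_mul (h t ht x) (h' t ht x) (norm_nonneg _) ((norm_nonneg _).trans (h t ht x))
    _ = K * K' * w x := by ring

theorem DomBy.bounded {u : ℝ → Space d → E} (h : DomBy tf (weight d) u) :
    DomBy tf (fun _ => 1) u := by
  obtain ⟨K, hK, h⟩ := h
  exact ⟨K, hK, fun t ht x => (h t ht x).trans (mul_le_mul_of_nonneg_left (weight_le_one x) hK)⟩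

theorem DomBy.const (c : E) : DomBy (d := d) tf (fun _ => 1) (fun _ _ => c) :=
  ⟨‖c‖, norm_nonneg _, fun _ _ _ => by simp⟩

theorem DomBy.comp_continuous [ProperSpace E] {u : ℝ → Space d → E} {g : E → E'}
    (hg : Continuous g) (h : DomBy tf (fun _ => 1) u) :
    DomBy tf (fun _ => 1) (fun t x => g (u t x)) := by
  obtain ⟨K, hK, h⟩ := h
  obtain ⟨P, hP⟩ := (isCompact_closedBall (0 : E) K).exists_bound_of_continuousOn hg.continuousOn
  refine ⟨max P 0, le_max_right _ _, fun t ht x => ?_⟩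
  rw [mul_one]
  exact (hP _ (mem_closedBall_zero_iff.2 (by simpa using h t ht x))).trans (le_max_left _ _)

theorem DomBy.euclidean {ι : Type*} [Fintype ι] {u : ℝ → Space d → EuclideanSpace ℝ ι}
    (h : ∀ i, DomBy tf w (fun t x => u t x i)) : DomBy tf w u := by
  classical
  have h1 : DomBy tf w (fun t x => ∑ i, ‖u t x i‖) := DomBy.sum fun i => (h i).norm
  refine h1.of_le fun t _ x => ?_
  conv_lhs => rw [eq_sum_single (u t x)]
  refine (norm_sum_le _ _).trans ((Finset.sum_le_sum fun i _ => ?_).trans (le_abs_self _))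
  rw [norm_smul, PiLp.norm_single]
  simp

end DomBy

/-- Fields that are differentiable in space and dominated by `w` together with their spatial
derivative. -/
structure DomC1 {d : ℕ} {E : Type*} [NormedAddCommGroup E] [NormedSpace ℝ E] (tf : ℝ)
    (w : Space d → ℝ) (u : ℝ → Space d → E) : Prop where
  diff : ∀ t ∈ Icc 0 tf, Differentiable ℝ (u t)
  bound : DomBy tf w u
  bound_fderiv : DomBy tf w (fun t x => fderiv ℝ (u t) x)

section DomC1

variable {d : ℕ} {tf : ℝ} {w : Space d → ℝ} {E E' : Type*}
  [NormedAddCommGroup E] [NormedSpace ℝ E] [NormedAddCommGroup E'] [NormedSpace ℝ E']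

theorem FastDecay.domC1 {u : ℝ → Space d → ℝ} (h : FastDecay tf u)
    (hu : ∀ t ∈ Icc 0 tf, Differentiable ℝ (u t)) : DomC1 tf (weight d) u := by
  obtain ⟨K, hK⟩ := h (d + 1)
  have key : ∀ (x : Space d) (a : ℝ), 0 ≤ a → (1 + ‖x‖) ^ (d + 1) * a ≤ K →
      a ≤ max K 0 * weight d x := by
    intro x a _ hle
    rw [weight, ← div_eq_mul_inv, le_div_iff₀ (by positivity), mul_comm]
    exact hle.trans (le_max_left _ _)
  exact ⟨hu, ⟨max K 0, le_max_right _ _, fun t ht x => key x _ (abs_nonneg _) (hK t ht x).1⟩,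
    ⟨max K 0, le_max_right _ _, fun t ht x => key x _ (norm_nonneg _) (hK t ht x).2⟩⟩

theorem DomC1.bounded {u : ℝ → Space d → E} (h : DomC1 tf (weight d) u) :
    DomC1 tf (fun _ => 1) u :=
  ⟨h.diff, h.bound.bounded, h.bound_fderiv.bounded⟩

theorem DomC1.add {u u' : ℝ → Space d → E} (h : DomC1 tf w u) (h' : DomC1 tf w u') :
    DomC1 tf w (fun t x => u t x + u' t x) := by
  refine ⟨fun t ht => (h.diff t ht).fun_add (h'.diff t ht), h.bound.add h'.bound,
    (h.bound_fderiv.add h'.bound_fderiv).of_le fun t ht x => ?_⟩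
  rw [fderiv_fun_add (h.diff t ht x) (h'.diff t ht x)]

theorem DomC1.sub {u u' : ℝ → Space d → E} (h : DomC1 tf w u) (h' : DomC1 tf w u') :
    DomC1 tf w (fun t x => u t x - u' t x) := by
  refine ⟨fun t ht => (h.diff t ht).fun_sub (h'.diff t ht), h.bound.sub h'.bound,
    (h.bound_fderiv.sub h'.bound_fderiv).of_le fun t ht x => ?_⟩
  rw [fderiv_fun_sub (h.diff t ht x) (h'.diff t ht x)]

theorem DomC1.sum {ι : Type*} [Fintype ι] {u : ι → ℝ → Space d → E}
    (h : ∀ i, DomC1 tf w (u i)) : DomC1 tf w (fun t x => ∑ i, u i t x) := by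
  refine ⟨fun t ht => Differentiable.fun_sum fun i _ => (h i).diff t ht,
    DomBy.sum fun i => (h i).bound,
    (DomBy.sum fun i => (h i).bound_fderiv).of_le fun t ht x => ?_⟩
  rw [fderiv_fun_sum fun i _ => (h i).diff t ht x]

theorem DomC1.const (c : E) : DomC1 (d := d) tf (fun _ => 1) (fun _ _ => c) :=
  ⟨fun _ _ => differentiable_const c, DomBy.const c,
    (DomBy.const (0 : E)).of_le fun _ _ _ => by simp⟩

theorem DomC1.mul {u u' : ℝ → Space d → ℝ} (h : DomC1 tf w u) (h' : DomC1 tf (fun _ => 1) u') :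
    DomC1 tf w (fun t x => u t x * u' t x) := by
  refine ⟨fun t ht => (h.diff t ht).fun_mul (h'.diff t ht),
    h.bound.of_le_norm_mul h'.bound fun t _ x => (norm_mul _ _).le, ?_⟩
  have h1 : DomBy tf w (fun t x => u t x • fderiv ℝ (u' t) x) :=
    h.bound.of_le_norm_mul h'.bound_fderiv fun t _ x => (norm_smul _ _).le
  have h2 : DomBy tf w (fun t x => u' t x • fderiv ℝ (u t) x) :=
    h.bound_fderiv.of_le_norm_mul h'.bound fun t _ x => by rw [norm_smul, mul_comm]
  refine (h1.add h2).of_le fun t ht x => ?_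
  rw [fderiv_fun_mul (h.diff t ht x) (h'.diff t ht x)]

theorem DomC1.comp [FiniteDimensional ℝ E] {u : ℝ → Space d → E} {g : E → E'}
    (hg : ContDiff ℝ 1 g) (h : DomC1 tf (fun _ => 1) u) :
    DomC1 tf (fun _ => 1) (fun t x => g (u t x)) := by
  have : ProperSpace E := FiniteDimensional.proper ℝ E
  have hgd : Differentiable ℝ g := hg.differentiable (by norm_num)
  refine ⟨fun t ht => hgd.comp (h.diff t ht), h.bound.comp_continuous hg.continuous, ?_⟩
  refine h.bound_fderiv.of_le_norm_mul
    (h.bound.comp_continuous (hg.continuous_fderiv (by norm_num))) fun t ht x => ?_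
  rw [fderiv_fun_comp x (hgd _) (h.diff t ht x), mul_comm]
  exact ContinuousLinearMap.opNorm_comp_le _ _

theorem DomC1.pi {ι : Type*} [Fintype ι] {u : ℝ → Space d → ι → E}
    (h : ∀ i, DomC1 tf w (fun t x => u t x i)) : DomC1 tf w u := by
  have hd : ∀ t ∈ Icc 0 tf, Differentiable ℝ (u t) := fun t ht =>
    differentiable_pi.2 fun i => (h i).diff t ht
  refine ⟨hd, ?_, ?_⟩
  · refine (DomBy.sum fun i => (h i).bound.norm).of_le fun t ht x => ?_
    refine le_trans ?_ (le_abs_self _)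
    refine (pi_norm_le_iff_of_nonneg (Finset.sum_nonneg fun i _ => norm_nonneg _)).2 fun i => ?_
    exact Finset.single_le_sum (f := fun i => ‖u t x i‖) (fun _ _ => norm_nonneg _)
      (Finset.mem_univ i)
  · refine (DomBy.sum fun i => (h i).bound_fderiv.norm).of_le fun t ht x => ?_
    refine le_trans ?_ (le_abs_self _)
    have h0 : ∀ i, 0 ≤ ‖fderiv ℝ (fun x => u t x i) x‖ := fun i => norm_nonneg _
    refine ContinuousLinearMap.opNorm_le_bound _ (Finset.sum_nonneg fun i _ => h0 i) fun y => ?_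
    refine (pi_norm_le_iff_of_nonneg
      (mul_nonneg (Finset.sum_nonneg fun i _ => h0 i) (norm_nonneg _))).2 fun i => ?_
    have e1 : fderiv ℝ (u t) x y i = fderiv ℝ (fun x => u t x i) x y := by
      rw [fderiv_pi fun i => (h i).diff t ht x]
      rfl
    rw [e1]
    refine (ContinuousLinearMap.le_opNorm _ _).trans
      (mul_le_mul_of_nonneg_right ?_ (norm_nonneg _))
    exact Finset.single_le_sum (f := fun i => ‖fderiv ℝ (fun x => u t x i) x‖) (fun i _ => h0 i)
      (Finset.mem_univ i)

theorem DomC1.bound_pd {u : ℝ → Space d → ℝ} (h : DomC1 tf w u) (α : Fin d) :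
    DomBy tf w (fun t x => pd α (u t) x) :=
  h.bound_fderiv.of_le fun t _ x => by
    refine ((fderiv ℝ (u t) x).le_opNorm _).trans_eq ?_
    simp

theorem DomBy.integrable {u : ℝ → Space d → ℝ} (h : DomBy tf (weight d) u) {t : ℝ}
    (ht : t ∈ Icc 0 tf) (hm : AEStronglyMeasurable (u t)) : Integrable (u t) := by
  obtain ⟨K, _, hK⟩ := h
  exact ((integrable_weight d).const_mul K).mono' hm (Eventually.of_forall fun x => hK t ht x)

theorem DomC1.integrable_pd {u : ℝ → Space d → ℝ} (h : DomC1 tf (weight d) u) {t : ℝ}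
    (ht : t ∈ Icc 0 tf) (α : Fin d) : Integrable (fun x => pd α (u t) x) :=
  (h.bound_pd α).integrable ht (measurable_fderiv_apply_const ℝ (u t) _).aestronglyMeasurable

/-- The integral of a partial derivative of a decaying field vanishes. -/
theorem DomC1.integral_pd {u : ℝ → Space d → ℝ} (h : DomC1 tf (weight d) u) {t : ℝ}
    (ht : t ∈ Icc 0 tf) (α : Fin d) : ∫ x, pd α (u t) x = 0 := by
  have h1 : Integrable (u t) :=
    h.bound.integrable ht (h.diff t ht).continuous.aestronglyMeasurable
  -- integration by parts against the constant function `1`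
  have h2 := integral_mul_fderiv_eq_neg_fderiv_mul_of_integrable (μ := (volume : Measure (Space d)))
    (f := fun _ : Space d => (1 : ℝ)) (g := u t) (v := EuclideanSpace.single α 1)
    (by simp) (by simpa [pd] using h.integrable_pd ht α) (by simpa using h1)
    (fun x _ => differentiableAt_const _) (fun x _ => h.diff t ht x)
  simpa [pd] using h2

end DomC1

/-- Gronwall's inequality for the integral over space of a density `e` that satisfies a differential
inequality up to a flux term of zero mean. -/
theorem integral_le_of_deriv_le {d : ℕ} {tf : ℝ} (htf : 0 < tf) {e : ℝ → Space d → ℝ}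
    (hcont : ∀ t ∈ Icc 0 tf, Continuous (e t))
    (hdiff : ∀ t ∈ Icc 0 tf, ∀ x, DifferentiableWithinAt ℝ (fun s => e s x) (Icc 0 tf) t)
    (hdom : DomBy tf (weight d) e)
    (hdom' : DomBy tf (weight d) (fun t x => derivWithin (fun s => e s x) (Icc 0 tf) t))
    {f : ℝ → Space d → ℝ} (hf : ∀ t ∈ Icc 0 tf, Integrable (f t))
    (hf0 : ∀ t ∈ Icc 0 tf, ∫ x, f t x = 0) {C : ℝ} (hC : 0 < C) {c : Space d → ℝ}
    (hc : Integrable c)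
    (hle : ∀ t ∈ Icc 0 tf, ∀ x,
      derivWithin (fun s => e s x) (Icc 0 tf) t - f t x ≤ C * e t x + c x) :
    ∀ t ∈ Icc 0 tf, ∫ x, e t x ≤
      Real.exp (C * t) * ((∫ x, e 0 x) + (∫ x, c x) / C) - (∫ x, c x) / C := by
  set I := ∫ x, c x with hI
  have hint : ∀ t ∈ Icc 0 tf, Integrable (e t) := fun t ht =>
    hdom.integrable ht (hcont t ht).aestronglyMeasurable
  obtain ⟨K, hK, hKb⟩ := hdom
  obtain ⟨K', hK', hKb'⟩ := hdom'
  have hEcont : ContinuousOn (fun t => ∫ x, e t x) (Icc 0 tf) :=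
    continuousOn_of_dominated (fun t ht => (hcont t ht).aestronglyMeasurable)
      (fun t ht => Eventually.of_forall fun x => hKb t ht x) ((integrable_weight d).const_mul K)
      (Eventually.of_forall fun x t ht => (hdiff t ht x).continuousWithinAt)
  have hder : ∀ t ∈ Ioo 0 tf, ∀ x,
      HasDerivAt (fun s => e s x) (derivWithin (fun s => e s x) (Icc 0 tf) t) t := fun t ht x =>
    (hdiff t (Ioo_subset_Icc_self ht) x).hasDerivWithinAt.hasDerivAt (Icc_mem_nhds ht.1 ht.2)
  have hE' : ∀ t ∈ Ioo 0 tf, ∃ E', E' ≤ C * (∫ x, e t x) + I ∧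
      HasDerivAt (fun t => ∫ x, e t x) E' t := by
    intro t ht
    have htI := Ioo_subset_Icc_self ht
    have hmeas : AEStronglyMeasurable
        (fun x => derivWithin (fun s => e s x) (Icc 0 tf) t) := by
      classical
      -- the derivative is a limit of difference quotients with times in the interval
      refine aestronglyMeasurable_of_tendsto_ae (𝓝[≠] t)
        (f := fun s x => if s ∈ Icc 0 tf then slope (fun s => e s x) t s else 0)
        (fun s => ?_) (Eventually.of_forall fun x => ?_)
      · by_cases hs : s ∈ Icc 0 tf
        · simp only [hs, if_true, slope_def_field]
          exact (((hcont s hs).sub (hcont t htI)).div_const _).aestronglyMeasurable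
        · simp only [hs, if_false]
          exact aestronglyMeasurable_const
      · refine (hasDerivAt_iff_tendsto_slope.1 (hder t ht x)).congr' ?_
        filter_upwards [nhdsWithin_le_nhds (Icc_mem_nhds ht.1 ht.2)] with s hs
        rw [if_pos hs]
    have h1 := hasDerivAt_integral_of_dominated_loc_of_deriv_le (μ := (volume : Measure (Space d)))
      (F := e) (F' := fun t x => derivWithin (fun s => e s x) (Icc 0 tf) t) (x₀ := t)
      (bound := fun x => K' * weight d x) (s := Ioo 0 tf) (Ioo_mem_nhds ht.1 ht.2)
      (by filter_upwards [Icc_mem_nhds ht.1 ht.2] with s hs using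
        (hcont s hs).aestronglyMeasurable)
      (hint t htI) hmeas
      (Eventually.of_forall fun x s hs => hKb' s (Ioo_subset_Icc_self hs) x)
      ((integrable_weight d).const_mul K')
      (Eventually.of_forall fun x s hs => hder s hs x)
    refine ⟨_, ?_, h1.2⟩
    have h2 : ∫ x, (derivWithin (fun s => e s x) (Icc 0 tf) t - f t x)
        ≤ ∫ x, (C * e t x + c x) :=
      integral_mono (h1.1.sub (hf t htI)) (((hint t htI).const_mul C).add hc) (hle t htI)
    rw [integral_sub h1.1 (hf t htI), hf0 t htI, integral_add ((hint t htI).const_mul C) hc,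
      integral_const_mul, sub_zero] at h2
    exact h2
  choose! E' hE'le hE' using hE'
  have hexp : ∀ t, HasDerivAt (fun t => Real.exp (-(C * t))) (Real.exp (-(C * t)) * -C) t := by
    intro t
    simpa using (((hasDerivAt_id t).const_mul C).neg).exp
  have hanti : AntitoneOn (fun t => Real.exp (-(C * t)) * ((∫ x, e t x) + I / C)) (Icc 0 tf) := by
    refine antitoneOn_of_hasDerivWithinAt_nonpos (convex_Icc 0 tf)
      (f' := fun t => Real.exp (-(C * t)) * -C * ((∫ x, e t x) + I / C)
        + Real.exp (-(C * t)) * E' t) ?_ ?_ ?_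
    · exact (Continuous.continuousOn (by fun_prop)).mul (hEcont.add continuousOn_const)
    · rw [interior_Icc]
      exact fun t ht => ((hexp t).fun_mul ((hE' t ht).add_const _)).hasDerivWithinAt
    · rw [interior_Icc]
      intro t ht
      have h1 := hE'le t ht
      have h2 : Real.exp (-(C * t)) * -C * ((∫ x, e t x) + I / C) + Real.exp (-(C * t)) * E' t
          = Real.exp (-(C * t)) * (E' t - (C * (∫ x, e t x) + I)) := by
        field_simp
        ring
      rw [h2]
      exact mul_nonpos_of_nonneg_of_nonpos (Real.exp_pos _).le (by linarith)
  intro t ht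
  have h1 := hanti (left_mem_Icc.2 htf.le) ht ht.1
  simp only [mul_zero, neg_zero, Real.exp_zero, one_mul] at h1
  rw [Real.exp_neg, inv_mul_le_iff₀ (Real.exp_pos _)] at h1
  linarith

/-! ### Decay of the relative energy and stability -/

section Fields

variable {d : ℕ} {tf : ℝ} {u u' : ℝ → Space d → Mat d}

theorem domC1_Phi (hu : ∀ i α, DomC1 tf (fun _ => 1) (fun t x => u t x i α)) :
    DomC1 tf (fun _ => 1) (fun t x => Phi (u t x)) :=
  DomC1.comp (u := fun t x => (fun i α => u t x i α)) (contDiff_Phi d)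
    (DomC1.pi fun i => DomC1.pi fun α => hu i α)

theorem domC1_dPhi (hd : d = 2 ∨ d = 3)
    (hu : ∀ i α, DomC1 tf (fun _ => 1) (fun t x => u t x i α)) (i α : Fin d) (A : MinorIdx d) :
    DomC1 tf (fun _ => 1) (fun t x => dPhi (u t x) i α A) := by
  obtain ⟨a, ℓ, ha⟩ := exists_dPhi_affine hd
  simp only [ha]
  exact DomC1.comp (g := fun Ξ => a i α A + ℓ i α A Ξ)
    (contDiff_const.add (ℓ i α A).contDiff) (domC1_Phi hu)

theorem domC1_gradient {σ : MinorSpace d → ℝ} (hσ : ContDiff ℝ 2 σ)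
    (hu : ∀ i α, DomC1 tf (fun _ => 1) (fun t x => u t x i α)) (A : MinorIdx d) :
    DomC1 tf (fun _ => 1) (fun t x => gradient σ (Phi (u t x)) A) := by
  simp only [gradient_apply]
  exact DomC1.comp (g := fun Ξ => fderiv ℝ σ Ξ (EuclideanSpace.single A 1))
    ((hσ.fderiv_right (m := 1) (by norm_num)).clm_apply contDiff_const) (domC1_Phi hu)

theorem domBy_Phi_sub {w : Space d → ℝ} (hu : ∀ i α, DomBy tf (fun _ => 1) (fun t x => u t x i α))
    (hu' : ∀ i α, DomBy tf (fun _ => 1) (fun t x => u' t x i α))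
    (h : ∀ i α, DomBy tf w (fun t x => u t x i α - u' t x i α)) :
    DomBy tf w (fun t x => Phi (u t x) - Phi (u' t x)) := by
  choose K hK hKb using hu
  choose K' hK' hKb' using hu'
  have hK0 : 0 ≤ ∑ i, ∑ α, (K i α + K' i α) :=
    Finset.sum_nonneg fun i _ => Finset.sum_nonneg fun α _ => add_nonneg (hK i α) (hK' i α)
  have hle : ∀ i α, K i α + K' i α ≤ ∑ i, ∑ α, (K i α + K' i α) := fun i α =>
    (Finset.single_le_sum (f := fun α => K i α + K' i α)
      (fun α _ => add_nonneg (hK i α) (hK' i α)) (Finset.mem_univ α)).trans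
    (Finset.single_le_sum (f := fun i => ∑ α, (K i α + K' i α))
      (fun i _ => Finset.sum_nonneg fun α _ => add_nonneg (hK i α) (hK' i α)) (Finset.mem_univ i))
  obtain ⟨L, hL, hLip⟩ := exists_Phi_lipschitz d hK0
  have hs : DomBy tf w (fun t x => ∑ i, ∑ α, ‖u t x i α - u' t x i α‖) :=
    DomBy.sum fun i => DomBy.sum fun α => (h i α).norm
  refine hs.of_le_mul hL fun t ht x => ?_
  have h0 : 0 ≤ ∑ i, ∑ α, ‖u t x i α - u' t x i α‖ := by positivity
  rw [Real.norm_of_nonneg h0]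
  refine hLip _ _ (fun i α => ?_) (fun i α => ?_) _ h0 fun i α => ?_
  · have := hKb i α t ht x
    rw [mul_one, Real.norm_eq_abs] at this
    linarith [hle i α, hK' i α]
  · have := hKb' i α t ht x
    rw [mul_one, Real.norm_eq_abs] at this
    linarith [hle i α, hK i α]
  · exact (Finset.single_le_sum (f := fun α => ‖u t x i α - u' t x i α‖)
      (fun α _ => norm_nonneg _) (Finset.mem_univ α)).trans
      (Finset.single_le_sum (f := fun i => ∑ α, ‖u t x i α - u' t x i α‖)
        (fun i _ => Finset.sum_nonneg fun α _ => norm_nonneg _) (Finset.mem_univ i))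

end Fields

section Solutions

variable {d : ℕ} {tf ε : ℝ} {σI σE : MinorSpace d → ℝ} {Fbar : Mat d}
  {vh v : ℝ → Space d → Space d} {Fh F : ℝ → Space d → Mat d} {T : ℝ → Space d → MinorSpace d}

theorem domC1_velocity
    (hv : ContDiffOn ℝ 1 (fun p : ℝ × Space d => v p.1 p.2) (Icc 0 tf ×ˢ univ))
    (hd : ∀ i, FastDecay tf (fun t x => v t x i)) (i : Fin d) :
    DomC1 tf (weight d) (fun t x => v t x i) :=
  (hd i).domC1 fun _ ht x => differentiableAt_coord (differentiable_slice_space hv ht x) i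

theorem domC1_strain_sub
    (hF : ∀ i α, ContDiffOn ℝ 1 (fun p : ℝ × Space d => F p.1 p.2 i α) (Icc 0 tf ×ˢ univ))
    (hd : ∀ i α, FastDecay tf (fun t x => F t x i α - Fbar i α)) (i α : Fin d) :
    DomC1 tf (weight d) (fun t x => F t x i α - Fbar i α) :=
  (hd i α).domC1 fun _ ht => (differentiable_slice_space (u := fun t x => F t x i α)
    (hF i α) ht).sub_const _

theorem domC1_strain
    (hF : ∀ i α, ContDiffOn ℝ 1 (fun p : ℝ × Space d => F p.1 p.2 i α) (Icc 0 tf ×ˢ univ))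
    (hd : ∀ i α, FastDecay tf (fun t x => F t x i α - Fbar i α)) (i α : Fin d) :
    DomC1 tf (fun _ => 1) (fun t x => F t x i α) := by
  simpa using (domC1_strain_sub hF hd i α).bounded.add (DomC1.const (Fbar i α))

theorem domC1_stress_sub (hS : IsRelaxationSolution σI σE ε tf v F T)
    (hSd : RelaxationDecay σE tf Fbar v F T) (A : MinorIdx d) :
    DomC1 tf (weight d) (fun t x => T t x A - gradient σE (Phi Fbar) A) :=
  (hSd.decay_T A).domC1 fun _ ht x => (differentiableAt_coord
    (differentiable_slice_space hS.contDiff_T ht x) A).sub_const _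

theorem domC1_stress (hS : IsRelaxationSolution σI σE ε tf v F T)
    (hSd : RelaxationDecay σE tf Fbar v F T) (A : MinorIdx d) :
    DomC1 tf (fun _ => 1) (fun t x => T t x A) := by
  simpa using (domC1_stress_sub hS hSd A).bounded.add (DomC1.const (gradient σE (Phi Fbar) A))

/-- The relative energy flux decays, together with its spatial derivatives. -/
theorem domC1_relFlux (hd : d = 2 ∨ d = 3) (h : AdmissiblePotentials σI σE)
    (hE : IsElasticSolution σE tf vh Fh) (hEd : ElasticDecay tf Fbar vh Fh)
    (hS : IsRelaxationSolution σI σE ε tf v F T) (hSd : RelaxationDecay σE tf Fbar v F T)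
    (α : Fin d) :
    DomC1 tf (weight d)
      (fun t x => relFlux σE (v t x) (F t x) (T t x) (vh t x) (Fh t x) α) := by
  refine DomC1.sum fun i => DomC1.sum fun A => ?_
  have hv := (domC1_velocity hS.contDiff_v hSd.decay_v i).sub
    (domC1_velocity hE.contDiff_v hEd.decay_v i)
  have hg := domC1_gradient (h.contDiff_E.of_le (by norm_num))
    (domC1_strain hE.contDiff_F hEd.decay_F) A
  have hP := domC1_dPhi hd (domC1_strain hS.contDiff_F hSd.decay_F) i α A
  have := (hv.mul ((domC1_stress hS hSd A).sub hg)).mul hP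
  simpa only [mul_comm (v _ _ i - vh _ _ i)] using this

theorem domBy_Phi_sub_Phi
    (hE : IsElasticSolution σE tf vh Fh) (hEd : ElasticDecay tf Fbar vh Fh)
    (hS : IsRelaxationSolution σI σE ε tf v F T) (hSd : RelaxationDecay σE tf Fbar v F T) :
    DomBy tf (weight d) (fun t x => Phi (F t x) - Phi (Fh t x)) :=
  domBy_Phi_sub (fun i α => (domC1_strain hS.contDiff_F hSd.decay_F i α).bound)
    (fun i α => (domC1_strain hE.contDiff_F hEd.decay_F i α).bound) fun i α => by
      simpa using (domC1_strain_sub hS.contDiff_F hSd.decay_F i α).bound.sub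
        (domC1_strain_sub hE.contDiff_F hEd.decay_F i α).bound

theorem domBy_velocity_sub
    (hE : IsElasticSolution σE tf vh Fh) (hEd : ElasticDecay tf Fbar vh Fh)
    (hS : IsRelaxationSolution σI σE ε tf v F T) (hSd : RelaxationDecay σE tf Fbar v F T) :
    DomBy tf (weight d) (fun t x => v t x - vh t x) :=
  DomBy.euclidean fun i => (domC1_velocity hS.contDiff_v hSd.decay_v i).bound.sub
    (domC1_velocity hE.contDiff_v hEd.decay_v i).bound

theorem domBy_stress_sub_equilibrium {M : ℝ} (hM : 0 ≤ M) (h : AdmissiblePotentials σI σE)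
    (hMb : DerivativeBounds M σE)
    (hS : IsRelaxationSolution σI σE ε tf v F T) (hSd : RelaxationDecay σE tf Fbar v F T) :
    DomBy tf (weight d) (fun t x => T t x - gradient σE (Phi (F t x))) := by
  have h1 : DomBy tf (weight d) (fun t x => T t x - gradient σE (Phi Fbar)) :=
    DomBy.euclidean fun A => (domC1_stress_sub hS hSd A).bound
  have h2 : DomBy tf (weight d) (fun t x => Phi (F t x) - Phi Fbar) :=
    domBy_Phi_sub (u' := fun _ _ => Fbar)
      (fun i α => (domC1_strain hS.contDiff_F hSd.decay_F i α).bound)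
      (fun i α => DomBy.const _) fun i α => (domC1_strain_sub hS.contDiff_F hSd.decay_F i α).bound
  have h3 : DomBy tf (weight d) (fun t x => gradient σE (Phi (F t x)) - gradient σE (Phi Fbar)) :=
    h2.of_le_mul hM fun t _ x => norm_gradient_sub_le_of_bounds h.contDiff_E hMb _ _
  simpa using h1.sub h3

theorem continuous_gradient {σ : MinorSpace d → ℝ} (hσ : ContDiff ℝ 2 σ) :
    Continuous (gradient σ) :=
  (InnerProductSpace.toDual ℝ (MinorSpace d)).symm.continuous.comp
    (hσ.continuous_fderiv (by norm_num))

theorem domBy_dissipation {M : ℝ} (hM : 0 ≤ M) (h : AdmissiblePotentials σI σE)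
    (hMb : DerivativeBounds M σE)
    (hS : IsRelaxationSolution σI σE ε tf v F T) (hSd : RelaxationDecay σE tf Fbar v F T) :
    DomBy tf (weight d) (fun t x => dissipation σI σE (F t x) (T t x)) := by
  have hΦ := (domC1_Phi (domC1_strain hS.contDiff_F hSd.decay_F)).bound
  have hT : DomBy tf (fun _ => 1) T := DomBy.euclidean fun A => (domC1_stress hS hSd A).bound
  have h1 := (hT.sub (hΦ.comp_continuous (continuous_gradient h.contDiff_I))).comp_continuous
    ((continuous_gradInv h).comp continuous_neg)
  refine (domBy_stress_sub_equilibrium hM h hMb hS hSd).of_le_norm_mul (hΦ.sub h1)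
    fun t _ x => ?_
  rw [dissipation_eq h, mul_comm]
  exact norm_inner_le_norm _ _

theorem relEnergy_nonneg {γI γv : ℝ} (h : AdmissiblePotentials σI σE)
    (hc : ConvexityBounds γI γv σI σE) (hγv : 0 < γv) (hγ : γv < γI) (v : Space d) (F : Mat d)
    (T : MinorSpace d) (vh : Space d) (Fh : Mat d) : 0 ≤ relEnergy σI σE v F T vh Fh := by
  refine le_trans ?_ (relEnergy_ge h hc hγv v F T vh Fh)
  have : 0 < γI - γv := sub_pos.2 hγ
  positivity

theorem domBy_relEnergy {γI γv M : ℝ} (hγv : 0 < γv) (hγ : γv < γI) (hM : 0 ≤ M)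
    (h : AdmissiblePotentials σI σE) (hc : ConvexityBounds γI γv σI σE)
    (hMb : DerivativeBounds M σE)
    (hE : IsElasticSolution σE tf vh Fh) (hEd : ElasticDecay tf Fbar vh Fh)
    (hS : IsRelaxationSolution σI σE ε tf v F T) (hSd : RelaxationDecay σE tf Fbar v F T) :
    DomBy tf (weight d)
      (fun t x => relEnergy σI σE (v t x) (F t x) (T t x) (vh t x) (Fh t x)) := by
  have hn := domBy_Phi_sub_Phi hE hEd hS hSd
  have hm := domBy_velocity_sub hE hEd hS hSd
  have hn2 : DomBy tf (weight d) (fun t x => M / 2 * ‖Phi (F t x) - Phi (Fh t x)‖ ^ 2) :=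
    (hn.of_le_norm_mul (p := fun t x => ‖Phi (F t x) - Phi (Fh t x)‖ ^ 2) hn.bounded
      fun t _ x => by simp [sq]).of_le_mul (L := M / 2) (by positivity)
      fun t _ x => by rw [norm_mul, Real.norm_of_nonneg (by positivity : 0 ≤ M / 2)]
  have hm2 : DomBy tf (weight d) (fun t x => 1 / 2 * ‖v t x - vh t x‖ ^ 2) :=
    (hm.of_le_norm_mul (p := fun t x => ‖v t x - vh t x‖ ^ 2) hm.bounded
      fun t _ x => by simp [sq]).of_le_mul (L := 1 / 2) (by positivity)
      fun t _ x => by rw [norm_mul, Real.norm_of_nonneg (by positivity : (0 : ℝ) ≤ 1 / 2)]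
  refine ((hm2.add (domBy_dissipation hM h hMb hS hSd)).add hn2).of_le fun t _ x => ?_
  rw [Real.norm_of_nonneg (relEnergy_nonneg h hc hγv hγ _ _ _ _ _)]
  exact (relEnergy_le h hMb _ _ _ _ _).trans (le_abs_self _)

theorem continuous_relEnergy (h : AdmissiblePotentials σI σE)
    (hE : IsElasticSolution σE tf vh Fh) (hS : IsRelaxationSolution σI σE ε tf v F T)
    {t : ℝ} (ht : t ∈ Icc 0 tf) :
    Continuous (fun x => relEnergy σI σE (v t x) (F t x) (T t x) (vh t x) (Fh t x)) := by
  simp only [relEnergy_eq]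
  have hE2 : ContDiff ℝ 2 σE := h.contDiff_E.of_le (by norm_num)
  have hv := (differentiable_slice_space hS.contDiff_v ht).continuous
  have hvh := (differentiable_slice_space hE.contDiff_v ht).continuous
  have hT := (differentiable_slice_space hS.contDiff_T ht).continuous
  have hΦ : Continuous fun x => Phi (F t x) := continuous_iff_continuousAt.2 fun x =>
    (hasFDerivAt_Phi fun i α => differentiable_slice_space (u := fun t x => F t x i α)
      (hS.contDiff_F i α) ht x).continuousAt
  have hΦh : Continuous fun x => Phi (Fh t x) := continuous_iff_continuousAt.2 fun x =>
    (hasFDerivAt_Phi fun i α => differentiable_slice_space (u := fun t x => Fh t x i α)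
      (hE.contDiff_F i α) ht x).continuousAt
  have hG : Continuous (G σI σE) := continuous_iff_continuousAt.2 fun τ =>
    (hasGradientAt_G h τ).continuousAt
  have hτ := hT.sub ((continuous_gradient h.contDiff_I).comp hΦ)
  have h1 := h.contDiff_I.continuous.comp hΦ
  have h2 := hE2.continuous.comp hΦh
  have h3 := (hE2.continuous_fderiv (by norm_num)).comp hΦh
  exact (((((hv.sub hvh).norm.pow 2).const_mul (1 / 2)).add
    ((h1.add (hΦ.inner hτ)).add (hG.comp hτ))).sub h2).sub (h3.clm_apply (hΦ.sub hΦh))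

end Solutions

/-- Stability of an elastic solution under relaxation, with a constant that depends on the elastic
solution only through a bound `K` of `F̂`, of its gradient and of the decay of `∇v̂`. -/
theorem exists_stability_const {d : ℕ} (hd : d = 2 ∨ d = 3) {tf : ℝ} (htf : 0 < tf)
    {γI γv M K : ℝ} (hγv : 0 < γv) (hγ : γv < γI) (hM : 0 < M) (hK : 0 ≤ K) (Fbar : Mat d) :
    ∃ C : ℝ, 0 < C ∧
      ∀ (σI σE : MinorSpace d → ℝ), AdmissiblePotentials σI σE →
      ConvexityBounds γI γv σI σE → DerivativeBounds M σE →
      ∀ (vh : ℝ → Space d → Space d) (Fh : ℝ → Space d → Mat d),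
      IsElasticSolution σE tf vh Fh → ElasticDecay tf Fbar vh Fh →
      (∀ t ∈ Icc 0 tf, ∀ x i α, |Fh t x i α| ≤ K) →
      (∀ t ∈ Icc 0 tf, ∀ x i α, |pd α (fun z => vh t z i) x| ≤ K * weight d x) →
      (∀ t ∈ Icc 0 tf, ∀ x i β α, |pd α (fun z => Fh t z i β) x| ≤ K) →
      ∀ (ε : ℝ), 0 < ε →
      ∀ (v : ℝ → Space d → Space d) (F : ℝ → Space d → Mat d) (T : ℝ → Space d → MinorSpace d),
      IsRelaxationSolution σI σE ε tf v F T → RelaxationDecay σE tf Fbar v F T →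
      ∀ t ∈ Icc 0 tf,
        Integrable (fun x => relEnergy σI σE (v t x) (F t x) (T t x) (vh t x) (Fh t x)) ∧
        ∫ x, relEnergy σI σE (v t x) (F t x) (T t x) (vh t x) (Fh t x)
          ≤ C * ((∫ x, relEnergy σI σE (v 0 x) (F 0 x) (T 0 x) (vh 0 x) (Fh 0 x)) + ε) := by
  obtain ⟨C₁, C₂, hC₁, hC₂, hbd⟩ := exists_errors_le hd (K := K) hγv hγ hM hK
  set C := 2 * C₁ + 1 with hC
  have hC0 : 0 < C := by positivity
  set W := ∫ x, weight d x with hW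
  have hW0 : 0 ≤ W := integral_nonneg fun x => (weight_pos x).le
  set b := γv * C₂ ^ 2 * K ^ 2 / 4 with hb
  have hb0 : 0 ≤ b := by positivity
  refine ⟨Real.exp (C * tf) * (1 + b * W / C), by positivity, ?_⟩
  intro σI σE h hc hMb vh Fh hE hEd hFhK hvhK hDFhK ε hε v F T hS hSd t ht
  set e : ℝ → Space d → ℝ := fun t x =>
    relEnergy σI σE (v t x) (F t x) (T t x) (vh t x) (Fh t x) with he
  have he0 : ∀ t x, 0 ≤ e t x := fun t x => relEnergy_nonneg h hc hγv hγ _ _ _ _ _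
  have hFhd : ∀ t ∈ Icc 0 tf, ∀ x i α, DifferentiableAt ℝ (fun z => Fh t z i α) x :=
    fun t ht x i α => differentiable_slice_space (u := fun t x => Fh t x i α)
      (hE.contDiff_F i α) ht x
  have hvhK1 : ∀ t ∈ Icc 0 tf, ∀ x i α, |pd α (fun z => vh t z i) x| ≤ K := fun t ht x i α =>
    (hvhK t ht x i α).trans (mul_le_of_le_one_right hK (weight_le_one x))
  have hdom : DomBy tf (weight d) e := domBy_relEnergy hγv hγ hM.le h hc hMb hE hEd hS hSd
  have hcont : ∀ t ∈ Icc 0 tf, Continuous (e t) := fun t ht => continuous_relEnergy h hE hS ht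
  have hflux := fun α => domC1_relFlux hd h hE hEd hS hSd α
  set f : ℝ → Space d → ℝ := fun t x => ∑ α, pd α
    (fun z => relFlux σE (v t z) (F t z) (T t z) (vh t z) (Fh t z) α) x with hf
  have hid : ∀ t ∈ Icc 0 tf, ∀ x, derivWithin (fun s => e s x) (Icc 0 tf) t
      = f t x - 1 / ε * dissipation σI σE (F t x) (T t x)
        + (Q1 σE (v t) (F t) (vh t) (Fh t) x + Q2 σE (F t) (vh t) (Fh t) x
          + Q3 σE (F t) (vh t) (Fh t) x) + linErr σE (F t) (T t) (vh t) x := by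
    intro t ht x
    have := (relEnergy_identity hd htf h hE hS ht x).2.2
    linarith
  have hQ := fun t ht x => (hbd σI σE h hc hMb (v t) (F t) (T t) (vh t) (Fh t) x (hFhd t ht x)
    (hFhK t ht x) (hvhK1 t ht x) (hDFhK t ht x)).1
  have hL := fun t ht x => (hbd σI σE h hc hMb (v t) (F t) (T t) (vh t) (Fh t) x (hFhd t ht x)
    (hFhK t ht x) (hvhK1 t ht x) (hDFhK t ht x)).2
  have hdom' : DomBy tf (weight d) (fun t x => derivWithin (fun s => e s x) (Icc 0 tf) t) := by
    have h1 : DomBy tf (weight d) f := DomBy.sum fun α => (hflux α).bound_pd α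
    have h2 : DomBy tf (weight d) (fun t x => 1 / ε * dissipation σI σE (F t x) (T t x)) :=
      (domBy_dissipation hM.le h hMb hS hSd).of_le_mul (L := 1 / ε) (by positivity)
        fun t _ x => by rw [norm_mul, Real.norm_of_nonneg (by positivity : 0 ≤ 1 / ε)]
    have h3 : DomBy tf (weight d) (fun t x => Q1 σE (v t) (F t) (vh t) (Fh t) x
        + Q2 σE (F t) (vh t) (Fh t) x + Q3 σE (F t) (vh t) (Fh t) x) :=
      hdom.of_le_mul hC₁ fun t ht x => (hQ t ht x).trans_eq
        (by rw [Real.norm_of_nonneg (he0 t x)])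
    have h4 : DomBy tf (weight d) (fun t x => C₁ * e t x) :=
      hdom.of_le_mul hC₁ fun t _ x => by rw [norm_mul, Real.norm_of_nonneg hC₁]
    have h5 : DomBy tf (weight d) (fun t x => C₂ * K * ‖T t x - gradient σE (Phi (F t x))‖) :=
      (domBy_stress_sub_equilibrium hM.le h hMb hS hSd).of_le_mul (L := C₂ * K) (by positivity)
        fun t _ x => by
          rw [norm_mul, norm_norm, Real.norm_of_nonneg (by positivity : 0 ≤ C₂ * K)]
    have h6 : DomBy tf (weight d) (fun t x => linErr σE (F t) (T t) (vh t) x) :=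
      (h4.add h5).of_le fun t ht x =>
        (hL t ht x K (hvhK1 t ht x)).trans (le_abs_self _)
    refine (((h1.sub h2).add h3).add h6).of_le fun t ht x => ?_
    rw [hid t ht x]
  have hfint : ∀ t ∈ Icc 0 tf, Integrable (f t) := fun t ht =>
    integrable_finsetSum _ fun α _ => (hflux α).integrable_pd ht α
  have hf0 : ∀ t ∈ Icc 0 tf, ∫ x, f t x = 0 := fun t ht => by
    rw [integral_finsetSum _ fun α _ => (hflux α).integrable_pd ht α]
    exact Finset.sum_eq_zero fun α _ => (hflux α).integral_pd ht α
  have hle : ∀ t ∈ Icc 0 tf, ∀ x, derivWithin (fun s => e s x) (Icc 0 tf) t - f t x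
      ≤ C * e t x + ε * b * weight d x := by
    intro t ht x
    set r := ‖T t x - gradient σE (Phi (F t x))‖ with hr
    set κ := K * weight d x with hκ
    have h1 := (le_abs_self _).trans (hQ t ht x)
    have h2 := (le_abs_self _).trans (hL t ht x κ (hvhK t ht x))
    have h3 := mul_le_mul_of_nonneg_left (dissipation_ge h hc hγv (F t x) (T t x))
      (by positivity : 0 ≤ 1 / ε)
    -- Young's inequality: the dissipation absorbs the linear error, at the price of a term
    -- of order `ε`
    have h4 : C₂ * κ * r ≤ 1 / ε * (1 / γv * r ^ 2) + ε * (γv * C₂ ^ 2 / 4) * κ ^ 2 := by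
      have : 0 ≤ 1 / ε * (1 / γv) * (r - γv * ε * C₂ * κ / 2) ^ 2 := by positivity
      have e1 : 1 / ε * (1 / γv) * (r - γv * ε * C₂ * κ / 2) ^ 2
          = 1 / ε * (1 / γv * r ^ 2) - C₂ * κ * r + ε * (γv * C₂ ^ 2 / 4) * κ ^ 2 := by
        field_simp
        ring
      linarith
    have h5 : ε * (γv * C₂ ^ 2 / 4) * κ ^ 2 ≤ ε * b * weight d x := by
      have e1 : ε * (γv * C₂ ^ 2 / 4) * κ ^ 2 = ε * b * (weight d x * weight d x) := by
        rw [hκ, hb]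
        ring
      rw [e1]
      exact mul_le_mul_of_nonneg_left
        (mul_le_of_le_one_right (weight_pos x).le (weight_le_one x)) (by positivity)
    have h6 := he0 t x
    rw [hid t ht x]
    have h7 : C * e t x = C₁ * e t x + C₁ * e t x + e t x := by
      rw [hC]
      ring
    linarith
  have hgr := integral_le_of_deriv_le htf hcont
    (fun t ht x => (relEnergy_identity hd htf h hE hS ht x).2.1) hdom hdom' hfint hf0 hC0
    ((integrable_weight d).const_mul (ε * b)) hle t ht
  refine ⟨hdom.integrable ht (hcont t ht).aestronglyMeasurable, hgr.trans ?_⟩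
  rw [integral_const_mul, ← hW]
  have hE0 : 0 ≤ ∫ x, e 0 x := integral_nonneg fun x => he0 0 x
  have hexp : Real.exp (C * t) ≤ Real.exp (C * tf) :=
    Real.exp_le_exp.2 (mul_le_mul_of_nonneg_left ht.2 hC0.le)
  have hq : 0 ≤ b * W / C := by positivity
  have e1 : ε * b * W / C = ε * (b * W / C) := by ring
  rw [e1]
  calc Real.exp (C * t) * ((∫ x, e 0 x) + ε * (b * W / C)) - ε * (b * W / C)
      ≤ Real.exp (C * t) * ((∫ x, e 0 x) + ε * (b * W / C)) := sub_le_self _ (by positivity)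
    _ ≤ Real.exp (C * tf) * ((∫ x, e 0 x) + ε * (b * W / C)) := by gcongr
    _ ≤ Real.exp (C * tf) * ((1 + b * W / C) * ((∫ x, e 0 x) + ε)) := by
        gcongr
        nlinarith [mul_nonneg hq hE0]
    _ = _ := by ring

/-! ### Dependence on the gradients, and convergence -/

/-- A decaying field is determined by its gradient. -/
theorem eq_of_pd_eq_of_domC1 {d : ℕ} (hd : d = 2 ∨ d = 3) {tf : ℝ} {u u' : ℝ → Space d → ℝ}
    (hu : DomC1 tf (weight d) u) (hu' : DomC1 tf (weight d) u')
    (h : ∀ t ∈ Icc 0 tf, ∀ x α, pd α (u t) x = pd α (u' t) x) {t : ℝ} (ht : t ∈ Icc 0 tf)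
    (x : Space d) : u t x = u' t x := by
  have hdiff := hu.sub hu'
  have hz : ∀ x, fderiv ℝ (fun x => u t x - u' t x) x = 0 := by
    intro x
    refine ContinuousLinearMap.coe_injective
      ((EuclideanSpace.basisFun (Fin d) ℝ).toBasis.ext fun α => ?_)
    rw [fderiv_fun_sub (hu.diff t ht x) (hu'.diff t ht x)]
    simpa [sub_eq_zero, pd] using h t ht x α
  have hconst : ∀ y, u t y - u' t y = u t x - u' t x := fun y =>
    is_const_of_fderiv_eq_zero (𝕜 := ℝ) (hdiff.diff t ht) hz y x
  -- an integrable constant on a space of infinite volume vanishes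
  have hint : Integrable (fun _ : Space d => u t x - u' t x) :=
    (hdiff.bound.integrable ht (hdiff.diff t ht).continuous.aestronglyMeasurable).congr
      (Eventually.of_forall hconst)
  have : Nontrivial (Space d) := by
    have : 0 < d := by omega
    have : Nonempty (Fin d) := ⟨⟨0, this⟩⟩
    infer_instance
  rw [integrable_const_iff] at hint
  rcases hint with h0 | h0
  · exact sub_eq_zero.1 h0
  · exact absurd h0.measure_univ_lt_top (by simp)

theorem norm_Phi_sub_sq_ge {d : ℕ} (F Fh : Mat d) :
    ∑ i, ∑ α, (F i α - Fh i α) ^ 2 ≤ ‖Phi F - Phi Fh‖ ^ 2 := by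
  rw [EuclideanSpace.norm_sq_eq, Fintype.sum_sum_type, Fintype.sum_prod_type]
  have h1 : ∀ i α, (F i α - Fh i α) ^ 2 = ‖(Phi F - Phi Fh) (Sum.inl (i, α))‖ ^ 2 := fun i α => by
    rw [Real.norm_eq_abs, sq_abs]
    rfl
  simp only [h1]
  exact le_add_of_nonneg_right (Finset.sum_nonneg fun _ _ => by positivity)

/-- The relative energy controls the distance between the states, including the internal
variable. -/
theorem dist_sq_le_relEnergy {d : ℕ} {γI γv : ℝ} {σI σE : MinorSpace d → ℝ}
    (h : AdmissiblePotentials σI σE) (hc : ConvexityBounds γI γv σI σE) (hγv : 0 < γv)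
    (hγ : γv < γI) (v : Space d) (F : Mat d) (T : MinorSpace d) (vh : Space d) (Fh : Mat d) :
    ‖v - vh‖ ^ 2 + ∑ i, ∑ α, (F i α - Fh i α) ^ 2 + ‖tau σI F T - tauInf σI σE Fh‖ ^ 2
      ≤ (2 + 2 / (γI - γv) * (1 + 2 * γv ^ 2) + 4 * γv) * relEnergy σI σE v F T vh Fh := by
  have hδ : 0 < γI - γv := sub_pos.2 hγ
  have hge := relEnergy_ge h hc hγv v F T vh Fh
  set e := relEnergy σI σE v F T vh Fh
  set n := ‖Phi F - Phi Fh‖ with hn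
  set r := ‖T - gradient σE (Phi F)‖ with hr
  have p1 : 0 ≤ (γI - γv) / 2 * n ^ 2 := by positivity
  have p2 : 0 ≤ 1 / (2 * γv) * r ^ 2 := by positivity
  have p3 : 0 ≤ 1 / 2 * ‖v - vh‖ ^ 2 := by positivity
  have hm2 : ‖v - vh‖ ^ 2 ≤ 2 * e := by linarith
  have hn2 : n ^ 2 ≤ 2 / (γI - γv) * e := by
    rw [div_mul_eq_mul_div, le_div_iff₀ hδ]
    linarith
  have hr2 : r ^ 2 ≤ 2 * γv * e := by
    have : 1 / (2 * γv) * r ^ 2 ≤ e := by linarith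
    rwa [one_div, inv_mul_le_iff₀ (by positivity)] at this
  have hτ : tau σI F T - tauInf σI σE Fh = (T - gradient σE (Phi F))
      - (gradient (σI - σE) (Phi F) - gradient (σI - σE) (Phi Fh)) := by
    have e1 : gradient (σE - σI) (Phi Fh) = -gradient (σI - σE) (Phi Fh) := by
      rw [← neg_sub σI σE]
      simp only [gradient]
      rw [fderiv_neg, map_neg]
    rw [tau, tauInf, e1, gradient_Sigma h (Phi F)]
    abel
  have hlip := norm_gradient_sub_le (contDiff_Sigma h) hγv hc.hess_Sigma_nonneg hc.upper
    (Phi F) (Phi Fh)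
  have hτ2 : ‖tau σI F T - tauInf σI σE Fh‖ ^ 2 ≤ 2 * r ^ 2 + 2 * (γv ^ 2 * n ^ 2) := by
    have h1 : ‖tau σI F T - tauInf σI σE Fh‖ ≤ r + γv * n := by
      rw [hτ]
      exact (norm_sub_le _ _).trans (add_le_add le_rfl hlip)
    calc _ ≤ (r + γv * n) ^ 2 := by gcongr
      _ ≤ _ := by nlinarith [sq_nonneg (r - γv * n)]
  have hF := norm_Phi_sub_sq_ge F Fh
  rw [← hn] at hF
  have h5 : (1 + 2 * γv ^ 2) * n ^ 2 ≤ (1 + 2 * γv ^ 2) * (2 / (γI - γv) * e) := by gcongr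
  linarith

/-- A bound of a decaying elastic solution and of its gradient that depends only on the gradient
and on the state at infinity, since these determine the solution. -/
theorem exists_bound_of_gradients {d : ℕ} (hd : d = 2 ∨ d = 3) (tf : ℝ) (Fbar : Mat d)
    (Dv : ℝ → Space d → Fin d → Fin d → ℝ) (DF : ℝ → Space d → Fin d → Fin d → Fin d → ℝ) :
    ∃ K : ℝ, 0 ≤ K ∧ ∀ (σE : MinorSpace d → ℝ) (vh : ℝ → Space d → Space d)
        (Fh : ℝ → Space d → Mat d),
      IsElasticSolution σE tf vh Fh → ElasticDecay tf Fbar vh Fh →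
      (∀ t ∈ Icc 0 tf, ∀ x i α, pd α (fun z => vh t z i) x = Dv t x i α) →
      (∀ t ∈ Icc 0 tf, ∀ x i β α, pd α (fun z => Fh t z i β) x = DF t x i β α) →
      (∀ t ∈ Icc 0 tf, ∀ x i α, |Fh t x i α| ≤ K) ∧
      (∀ t ∈ Icc 0 tf, ∀ x i α, |pd α (fun z => vh t z i) x| ≤ K * weight d x) ∧
      (∀ t ∈ Icc 0 tf, ∀ x i β α, |pd α (fun z => Fh t z i β) x| ≤ K) := by
  by_cases hex : ∃ (σE : MinorSpace d → ℝ) (vh : ℝ → Space d → Space d) (Fh : ℝ → Space d → Mat d),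
      IsElasticSolution σE tf vh Fh ∧ ElasticDecay tf Fbar vh Fh ∧
      (∀ t ∈ Icc 0 tf, ∀ x i α, pd α (fun z => vh t z i) x = Dv t x i α) ∧
      (∀ t ∈ Icc 0 tf, ∀ x i β α, pd α (fun z => Fh t z i β) x = DF t x i β α)
  swap
  · exact ⟨0, le_rfl, fun σE vh Fh h1 h2 h3 h4 => absurd ⟨σE, vh, Fh, h1, h2, h3, h4⟩ hex⟩
  -- the bounds of one solution with the given gradients serve for all of them
  obtain ⟨σ₀, v₀, F₀, hE₀, hEd₀, hv₀, hF₀⟩ := hex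
  choose K1 hK1 hK1b using fun i α => (domC1_strain hE₀.contDiff_F hEd₀.decay_F i α).bound
  choose K2 hK2 hK2b using fun i α =>
    (domC1_velocity hE₀.contDiff_v hEd₀.decay_v i).bound_pd α
  choose K3 hK3 hK3b using fun i β α =>
    (domC1_strain hE₀.contDiff_F hEd₀.decay_F i β).bound_pd α
  set K := ∑ i, ∑ β, (K1 i β + K2 i β + ∑ α, K3 i β α) with hK
  have hs : ∀ i β, 0 ≤ ∑ α, K3 i β α := fun i β => Finset.sum_nonneg fun α _ => hK3 i β α
  have ht0 : ∀ i β, 0 ≤ K1 i β + K2 i β + ∑ α, K3 i β α := fun i β =>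
    add_nonneg (add_nonneg (hK1 i β) (hK2 i β)) (hs i β)
  have hle : ∀ i β, K1 i β + K2 i β + ∑ α, K3 i β α ≤ K := fun i β =>
    (Finset.single_le_sum (f := fun β => K1 i β + K2 i β + ∑ α, K3 i β α)
      (fun β _ => ht0 i β) (Finset.mem_univ β)).trans
    (Finset.single_le_sum (f := fun i => ∑ β, (K1 i β + K2 i β + ∑ α, K3 i β α))
      (fun i _ => Finset.sum_nonneg fun β _ => ht0 i β) (Finset.mem_univ i))
  have hle3 : ∀ i β α, K3 i β α ≤ K := fun i β α => by
    have := Finset.single_le_sum (f := fun α => K3 i β α) (fun α _ => hK3 i β α)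
      (Finset.mem_univ α)
    linarith [hle i β, hK1 i β, hK2 i β]
  refine ⟨K, Finset.sum_nonneg fun i _ => Finset.sum_nonneg fun β _ => ht0 i β, ?_⟩
  intro σE vh Fh hE hEd hv hF
  refine ⟨fun t ht x i α => ?_, fun t ht x i α => ?_, fun t ht x i β α => ?_⟩
  · have h1 := eq_of_pd_eq_of_domC1 hd (domC1_strain_sub hE.contDiff_F hEd.decay_F i α)
      (domC1_strain_sub hE₀.contDiff_F hEd₀.decay_F i α) (fun t ht x β => by
        rw [pd_sub (differentiable_slice_space (u := fun t x => Fh t x i α)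
            (hE.contDiff_F i α) ht x) (differentiableAt_const _),
          pd_sub (differentiable_slice_space (u := fun t x => F₀ t x i α)
            (hE₀.contDiff_F i α) ht x) (differentiableAt_const _), hF t ht, hF₀ t ht]) ht x
    have h2 := hK1b i α t ht x
    rw [mul_one, Real.norm_eq_abs] at h2
    rw [sub_left_inj.1 h1]
    linarith [hle i α, hK2 i α, hs i α]
  · rw [hv t ht, ← hv₀ t ht]
    refine (hK2b i α t ht x).trans (mul_le_mul_of_nonneg_right ?_ (weight_pos x).le)
    linarith [hle i α, hK1 i α, hs i α]
  · rw [hF t ht, ← hF₀ t ht]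
    exact (hK3b i β α t ht x).trans (by simpa using hle3 i β α)

end PolyRelax

theorem theorem4p1 (d : ℕ) (hd : d = 2 ∨ d = 3) (tf : ℝ) (htf : 0 < tf)
    (γI γv M : ℝ) (hγv : 0 < γv) (hγ : γv < γI) (hM : 0 < M) (Fbar : PolyRelax.Mat d) :
    -- the relative energy identity
    (∀ (σI σE : PolyRelax.MinorSpace d → ℝ), PolyRelax.AdmissiblePotentials σI σE →
      ∀ (vh : ℝ → PolyRelax.Space d → PolyRelax.Space d)
        (Fh : ℝ → PolyRelax.Space d → PolyRelax.Mat d),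
      PolyRelax.IsElasticSolution σE tf vh Fh →
      ∀ (ε : ℝ), 0 < ε →
      ∀ (v : ℝ → PolyRelax.Space d → PolyRelax.Space d)
        (F : ℝ → PolyRelax.Space d → PolyRelax.Mat d)
        (T : ℝ → PolyRelax.Space d → PolyRelax.MinorSpace d),
      PolyRelax.IsRelaxationSolution σI σE ε tf v F T →
      ∀ t ∈ Icc 0 tf, ∀ x : PolyRelax.Space d,
        (∀ α, DifferentiableAt ℝ
          (fun z => PolyRelax.relFlux σE (v t z) (F t z) (T t z) (vh t z) (Fh t z) α) x) ∧
        DifferentiableWithinAt ℝ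
          (fun s => PolyRelax.relEnergy σI σE (v s x) (F s x) (T s x) (vh s x) (Fh s x))
          (Icc 0 tf) t ∧
        derivWithin
            (fun s => PolyRelax.relEnergy σI σE (v s x) (F s x) (T s x) (vh s x) (Fh s x))
            (Icc 0 tf) t
          - ∑ α, PolyRelax.pd α
              (fun z => PolyRelax.relFlux σE (v t z) (F t z) (T t z) (vh t z) (Fh t z) α) x
          + 1 / ε * PolyRelax.dissipation σI σE (F t x) (T t x)
        = PolyRelax.Q1 σE (v t) (F t) (vh t) (Fh t) x
          + PolyRelax.Q2 σE (F t) (vh t) (Fh t) x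
          + PolyRelax.Q3 σE (F t) (vh t) (Fh t) x
          + PolyRelax.linErr σE (F t) (T t) (vh t) x) ∧
    -- stability: the constant `C` depends only on `d`, `tf`, `γI`, `γv`, `M`, the state `Fbar` at
    -- infinity, and the spatial gradients `Dv`, `DF` of the solution `(vh, Fh)`
    (∀ (Dv : ℝ → PolyRelax.Space d → Fin d → Fin d → ℝ)
       (DF : ℝ → PolyRelax.Space d → Fin d → Fin d → Fin d → ℝ),
      ∃ C : ℝ, 0 < C ∧
      ∀ (σI σE : PolyRelax.MinorSpace d → ℝ), PolyRelax.AdmissiblePotentials σI σE →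
      PolyRelax.ConvexityBounds γI γv σI σE → PolyRelax.DerivativeBounds M σE →
      ∀ (vh : ℝ → PolyRelax.Space d → PolyRelax.Space d)
        (Fh : ℝ → PolyRelax.Space d → PolyRelax.Mat d),
      PolyRelax.IsElasticSolution σE tf vh Fh → PolyRelax.ElasticDecay tf Fbar vh Fh →
      (∀ t ∈ Icc 0 tf, ∀ x i α, PolyRelax.pd α (fun z => vh t z i) x = Dv t x i α) →
      (∀ t ∈ Icc 0 tf, ∀ x i β α, PolyRelax.pd α (fun z => Fh t z i β) x = DF t x i β α) →
      ∀ (ε : ℝ), 0 < ε →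
      ∀ (v : ℝ → PolyRelax.Space d → PolyRelax.Space d)
        (F : ℝ → PolyRelax.Space d → PolyRelax.Mat d)
        (T : ℝ → PolyRelax.Space d → PolyRelax.MinorSpace d),
      PolyRelax.IsRelaxationSolution σI σE ε tf v F T →
      PolyRelax.RelaxationDecay σE tf Fbar v F T →
      ∀ t ∈ Icc 0 tf,
        Integrable (fun x =>
          PolyRelax.relEnergy σI σE (v t x) (F t x) (T t x) (vh t x) (Fh t x)) ∧
        ∫ x, PolyRelax.relEnergy σI σE (v t x) (F t x) (T t x) (vh t x) (Fh t x)
          ≤ C * ((∫ x, PolyRelax.relEnergy σI σE (v 0 x) (F 0 x) (T 0 x) (vh 0 x) (Fh 0 x))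
              + ε)) ∧
    -- convergence for well-prepared data
    (∀ (σI σE : PolyRelax.MinorSpace d → ℝ), PolyRelax.AdmissiblePotentials σI σE →
      PolyRelax.ConvexityBounds γI γv σI σE → PolyRelax.DerivativeBounds M σE →
      ∀ (vh : ℝ → PolyRelax.Space d → PolyRelax.Space d)
        (Fh : ℝ → PolyRelax.Space d → PolyRelax.Mat d),
      PolyRelax.IsElasticSolution σE tf vh Fh → PolyRelax.ElasticDecay tf Fbar vh Fh →
      ∀ (v : ℝ → ℝ → PolyRelax.Space d → PolyRelax.Space d)
        (F : ℝ → ℝ → PolyRelax.Space d → PolyRelax.Mat d)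
        (T : ℝ → ℝ → PolyRelax.Space d → PolyRelax.MinorSpace d),
      (∀ᶠ ε in 𝓝[>] (0 : ℝ), PolyRelax.IsRelaxationSolution σI σE ε tf (v ε) (F ε) (T ε) ∧
        PolyRelax.RelaxationDecay σE tf Fbar (v ε) (F ε) (T ε)) →
      Tendsto (fun ε => ∫ x,
          PolyRelax.relEnergy σI σE (v ε 0 x) (F ε 0 x) (T ε 0 x) (vh 0 x) (Fh 0 x))
        (𝓝[>] 0) (𝓝 0) →
      Tendsto (fun ε => ⨆ t ∈ Icc 0 tf, ∫⁻ x, ENNReal.ofReal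
          (‖v ε t x - vh t x‖ ^ 2 + ∑ i, ∑ α, (F ε t x i α - Fh t x i α) ^ 2
            + ‖PolyRelax.tau σI (F ε t x) (T ε t x) - PolyRelax.tauInf σI σE (Fh t x)‖ ^ 2))
        (𝓝[>] 0) (𝓝 0)) := by
  have stability : ∀ (Dv : ℝ → PolyRelax.Space d → Fin d → Fin d → ℝ)
      (DF : ℝ → PolyRelax.Space d → Fin d → Fin d → Fin d → ℝ),
      ∃ C : ℝ, 0 < C ∧
      ∀ (σI σE : PolyRelax.MinorSpace d → ℝ), PolyRelax.AdmissiblePotentials σI σE →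
      PolyRelax.ConvexityBounds γI γv σI σE → PolyRelax.DerivativeBounds M σE →
      ∀ (vh : ℝ → PolyRelax.Space d → PolyRelax.Space d)
        (Fh : ℝ → PolyRelax.Space d → PolyRelax.Mat d),
      PolyRelax.IsElasticSolution σE tf vh Fh → PolyRelax.ElasticDecay tf Fbar vh Fh →
      (∀ t ∈ Icc 0 tf, ∀ x i α, PolyRelax.pd α (fun z => vh t z i) x = Dv t x i α) →
      (∀ t ∈ Icc 0 tf, ∀ x i β α, PolyRelax.pd α (fun z => Fh t z i β) x = DF t x i β α) →
      ∀ (ε : ℝ), 0 < ε →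
      ∀ (v : ℝ → PolyRelax.Space d → PolyRelax.Space d)
        (F : ℝ → PolyRelax.Space d → PolyRelax.Mat d)
        (T : ℝ → PolyRelax.Space d → PolyRelax.MinorSpace d),
      PolyRelax.IsRelaxationSolution σI σE ε tf v F T →
      PolyRelax.RelaxationDecay σE tf Fbar v F T →
      ∀ t ∈ Icc 0 tf,
        Integrable (fun x =>
          PolyRelax.relEnergy σI σE (v t x) (F t x) (T t x) (vh t x) (Fh t x)) ∧
        ∫ x, PolyRelax.relEnergy σI σE (v t x) (F t x) (T t x) (vh t x) (Fh t x)
          ≤ C * ((∫ x, PolyRelax.relEnergy σI σE (v 0 x) (F 0 x) (T 0 x) (vh 0 x) (Fh 0 x))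
              + ε) := by
    intro Dv DF
    obtain ⟨K, hK, hKb⟩ := PolyRelax.exists_bound_of_gradients hd tf Fbar Dv DF
    obtain ⟨C, hC, hCb⟩ := PolyRelax.exists_stability_const hd htf hγv hγ hM hK Fbar
    refine ⟨C, hC, fun σI σE h hc hMb vh Fh hE hEd hv hF ε hε v F T hS hSd => ?_⟩
    obtain ⟨h1, h2, h3⟩ := hKb σE vh Fh hE hEd hv hF
    exact hCb σI σE h hc hMb vh Fh hE hEd h1 h2 h3 ε hε v F T hS hSd
  refine ⟨?_, stability, ?_⟩
  · intro σI σE h vh Fh hE ε _ v F T hS t ht x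
    exact PolyRelax.relEnergy_identity hd htf h hE hS ht x
  · intro σI σE h hc hMb vh Fh hE hEd v F T hS hlim
    obtain ⟨C, -, hCb⟩ := stability (fun t x i α => PolyRelax.pd α (fun z => vh t z i) x)
      (fun t x i β α => PolyRelax.pd α (fun z => Fh t z i β) x)
    set Λ : ℝ := 2 + 2 / (γI - γv) * (1 + 2 * γv ^ 2) + 4 * γv with hΛ
    have hΛ0 : 0 ≤ Λ := by
      have : 0 < γI - γv := sub_pos.2 hγ
      positivity
    have hlim2 : Tendsto (fun ε => ENNReal.ofReal (Λ * (C * ((∫ x, PolyRelax.relEnergy σI σE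
        (v ε 0 x) (F ε 0 x) (T ε 0 x) (vh 0 x) (Fh 0 x)) + ε)))) (𝓝[>] 0) (𝓝 0) := by
      have h1 : Tendsto (fun ε : ℝ => ε) (𝓝[>] 0) (𝓝 0) :=
        tendsto_nhdsWithin_of_tendsto_nhds tendsto_id
      have h2 := ENNReal.tendsto_ofReal (((hlim.add h1).const_mul C).const_mul Λ)
      simpa using h2
    refine tendsto_of_tendsto_of_tendsto_of_le_of_le' tendsto_const_nhds hlim2
      (Eventually.of_forall fun _ => bot_le) ?_
    filter_upwards [hS, self_mem_nhdsWithin] with ε hSε hε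
    refine iSup₂_le fun t ht => ?_
    obtain ⟨hint, hle⟩ := hCb σI σE h hc hMb vh Fh hE hEd (fun _ _ _ _ _ => rfl)
      (fun _ _ _ _ _ _ => rfl) ε hε (v ε) (F ε) (T ε) hSε.1 hSε.2 t ht
    calc _ ≤ ∫⁻ x, ENNReal.ofReal (Λ * PolyRelax.relEnergy σI σE (v ε t x) (F ε t x) (T ε t x)
          (vh t x) (Fh t x)) := lintegral_mono fun x =>
          ENNReal.ofReal_le_ofReal (PolyRelax.dist_sq_le_relEnergy h hc hγv hγ _ _ _ _ _)
      _ = ENNReal.ofReal (∫ x, Λ * PolyRelax.relEnergy σI σE (v ε t x) (F ε t x) (T ε t x)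
          (vh t x) (Fh t x)) :=
          (ofReal_integral_eq_lintegral_ofReal (hint.const_mul Λ) (Eventually.of_forall fun x =>
            mul_nonneg hΛ0 (PolyRelax.relEnergy_nonneg h hc hγv hγ _ _ _ _ _))).symm
      _ ≤ _ := by
          rw [integral_const_mul]
          exact ENNReal.ofReal_le_ofReal (mul_le_mul_of_nonneg_left hle hΛ0)
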